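/- Let $n,k,r$ be integers with $n\ge k\ge 5$ and $\lfloor (k-1)/2\rfloor+2\le r<k$. Let $\mathrm{ex}(m,K_r)$ denote the maximum number of edges of an $m$-vertex graph that contains no complete graph $K_r$, and put $$g_r(n,a,k)=a(n-k+a)+\mathrm{ex}(k-a,K_r).$$ Then the maximum number of edges in a $2$-connected $n$-vertex graph that contains neither $K_r$ nor any cycle of length at least $k$ as a (not necessarily induced) subgraph is equal to $$\max\left\{g_r(n,2,k),\ g_r\!\left(n,\left\lfloor \tfrac{k-1}{2}\right\rfloor,k\right)\right\}.$$ (In particular such graphs exist and the maximum is attained.) -/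

import Mathlib

/-- A finite graph is 2-connected if it has at least three vertices, is connected, and remains
connected after the deletion of any single vertex. -/
def IsTwoConnected {V : Type*} [Fintype V] (G : SimpleGraph V) : Prop :=
  3 ≤ Fintype.card V ∧ G.Connected ∧ ∀ v : V, (G.induce {v}ᶜ).Connected

/-- `G` contains no cycle of length at least `k` as a subgraph. -/
def LongCycleFree {V : Type*} (G : SimpleGraph V) (k : ℕ) : Prop :=
  ∀ (v : V) (p : G.Walk v v), p.IsCycle → p.length < k

/-- The set of all numbers of edges of 2-connected graphs on `n` vertices that contain neither
`K_r` nor a cycle of length at least `k`. -/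
def twoConnEdgeCounts (n r k : ℕ) : Set ℕ :=
  {m | ∃ G : SimpleGraph (Fin n),
    IsTwoConnected G ∧ G.CliqueFree r ∧ LongCycleFree G k ∧ G.edgeSet.ncard = m}

/-- `g_r(n, a, k) = a (n - k + a) + ex(k - a, K_r)`; it is used for `a ≤ k ≤ n` only, where the
subtractions are exact. -/
noncomputable def gTuran (r n a k : ℕ) : ℕ :=
  a * (n - k + a) + SimpleGraph.extremalNumber (k - a) (⊤ : SimpleGraph (Fin r))

/-! The upper bound is Kopylov's disintegration argument. Add edges to G until every missing edge
would close a cycle on at least k vertices. The resulting G' may contain K_r; clique-freeness is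
used for G only. Pósa's lemma (`CycleListsShort.countP_lt`) shows that in G' vertices of large
degree inside suitable sets are adjacent (`SaturatedFor.adj_of_degrees`).

Let t = ⌊(k-1)/2⌋ and let K be the largest set whose vertices all have more than t G'-neighbours in
it. If K is empty, deleting vertices of degree at most t until k-t remain gives e(G) ≤ g_r(n,t,k).
Otherwise K is a clique of G' with t+2 ≤ |K| ≤ k-2. With a = k-|K|, the analogous set for threshold
a is again K, so deletion down to K gives e(G) ≤ g_r(n,a,k) with 2 ≤ a ≤ t. Convexity of g_r in a
leaves only a = 2 and a = t.

For the lower bound, take the Turán graph with r-1 parts on k-a vertices and join a vertices from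
distinct parts to n-k+a further independent vertices. Cycles enter and leave the independent set
only through those a vertices, which keeps them shorter than k. -/

/-- `l` lists the vertices of a path of `G` from `x` to `y`. -/
def PathList {V : Type*} (G : SimpleGraph V) (l : List V) (x y : V) : Prop :=
  l.IsChain G.Adj ∧ l.Nodup ∧ l.head? = some x ∧ l.getLast? = some y

/-- All cycles of `G`, given as closed lists of vertices, have fewer than `k` vertices. -/
def CycleListsShort {V : Type*} (G : SimpleGraph V) (k : ℕ) : Prop :=
  ∀ l x y, PathList G l x y → 3 ≤ l.length → G.Adj y x → l.length < k

/-- Any two vertices other than `v` are joined by a path avoiding `v`. -/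
def NoCutVertex {V : Type*} (G : SimpleGraph V) : Prop :=
  ∀ v a b, a ≠ v → b ≠ v → ∃ l, PathList G l a b ∧ v ∉ l

/-! ### Operations on paths given as vertex lists. -/

namespace PathList

variable {V : Type*} {G : SimpleGraph V} {l l₁ l₂ : List V} {x y z w : V}

lemma left_mem (h : PathList G l x y) : x ∈ l := List.mem_of_mem_head? (by simp [h.2.2.1])

lemma right_mem (h : PathList G l x y) : y ∈ l := List.mem_of_mem_getLast? (by simp [h.2.2.2])

lemma single (x : V) : PathList G [x] x x := by simp [PathList]

lemma reverse (h : PathList G l x y) : PathList G l.reverse y x := by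
  refine ⟨?_, by simpa using h.2.1, by simpa using h.2.2.2, by simpa using h.2.2.1⟩
  rw [List.isChain_reverse]
  exact h.1.imp fun a b hab => hab.symm

lemma append (h₁ : PathList G l₁ x y) (h₂ : PathList G l₂ z w) (hyz : G.Adj y z)
    (hd : ∀ v ∈ l₁, v ∉ l₂) : PathList G (l₁ ++ l₂) x w := by
  refine ⟨?_, ?_, by simp [h₁.2.2.1], by simp [h₂.2.2.2]⟩
  · rw [List.isChain_append]
    refine ⟨h₁.1, h₂.1, ?_⟩
    simp [h₁.2.2.2, h₂.2.2.1, hyz]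
  · rw [List.nodup_append]
    exact ⟨h₁.2.1, h₂.2.1, fun a ha b hb hab => hd a ha (hab ▸ hb)⟩

lemma cons (h : PathList G l x y) (hzx : G.Adj z x) (hz : z ∉ l) : PathList G (z :: l) z y :=
  (single z).append h hzx (by simpa using hz)

lemma concat (h : PathList G l x y) (hyz : G.Adj y z) (hz : z ∉ l) :
    PathList G (l ++ [z]) x z :=
  h.append (single z) hyz (by rintro v hv; simp; rintro rfl; exact hz hv)

/-- Splitting a path at a vertex. -/
lemma left_of_append_cons (h : PathList G (l₁ ++ z :: l₂) x y) : PathList G (l₁ ++ [z]) x z := by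
  obtain ⟨h1, h2, h3, h4⟩ := h
  have e : l₁ ++ z :: l₂ = (l₁ ++ [z]) ++ l₂ := by simp
  refine ⟨?_, ?_, ?_, by simp⟩
  · rw [e] at h1; exact h1.left_of_append
  · rw [e] at h2; exact (List.nodup_append.1 h2).1
  · cases l₁ <;> simpa using h3

lemma right_of_append_cons (h : PathList G (l₁ ++ z :: l₂) x y) : PathList G (z :: l₂) z y := by
  obtain ⟨h1, h2, h3, h4⟩ := h
  exact ⟨h1.right_of_append, (List.nodup_append.1 h2).2.1, by simp, by simpa using h4⟩

lemma eq_of_cons (h : PathList G (z :: l) x y) : z = x := by simpa using h.2.2.1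

/-- Gluing two paths at a common end. -/
lemma glue (h₁ : PathList G l₁ x y) (h₂ : PathList G l₂ y z)
    (hd : ∀ v ∈ l₁, v ∈ l₂ → v = y) :
    ∃ l, PathList G l x z ∧ ∀ v, v ∈ l ↔ v ∈ l₁ ∨ v ∈ l₂ := by
  cases l₂ with
  | nil => simp [PathList] at h₂
  | cons a l₂ =>
    obtain rfl := h₂.eq_of_cons
    cases l₂ with
    | nil =>
      have : a = z := by simpa [PathList] using h₂
      subst this
      exact ⟨l₁, h₁, fun v => by
        have := h₁.right_mem
        simp; rintro rfl; exact this⟩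
    | cons b l₂ =>
      obtain ⟨c1, c2, c3, c4⟩ := h₂
      have hb : PathList G (b :: l₂) b z :=
        ⟨(List.isChain_cons_cons.1 c1).2, (List.nodup_cons.1 c2).2, by simp, by simpa using c4⟩
      refine ⟨_, h₁.append hb (List.isChain_cons_cons.1 c1).1 ?_, ?_⟩
      · intro v hv hv'
        obtain rfl := hd v hv (List.mem_cons_of_mem _ hv')
        exact (List.nodup_cons.1 c2).1 hv'
      · intro v
        have := h₁.right_mem
        simp only [List.mem_append, List.mem_cons]
        constructor
        · tauto
        · rintro (h | rfl | h | h) <;> tauto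

/-- Two internally disjoint paths with the same ends form a cycle. -/
lemma exists_cycle (h₁ : PathList G l₁ x y) (h₂ : PathList G l₂ x y) (hxy : x ≠ y)
    (hd : ∀ v ∈ l₁, v ∈ l₂ → v = x ∨ v = y) :
    ∃ l w, PathList G l x w ∧ G.Adj w x ∧ ∀ v, v ∈ l ↔ v ∈ l₁ ∨ v ∈ l₂ := by
  cases l₂ with
  | nil => simp [PathList] at h₂
  | cons a l₂ =>
    obtain rfl := h₂.eq_of_cons
    obtain ⟨c1, c2, c3, c4⟩ := h₂
    cases l₂ with
    | nil => simp at c4; exact absurd c4 hxy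
    | cons b l₂ =>
      have hb : PathList G (b :: l₂) b y :=
        ⟨(List.isChain_cons_cons.1 c1).2, (List.nodup_cons.1 c2).2, by simp, by simpa using c4⟩
      obtain ⟨l, hl, hm⟩ := h₁.glue hb.reverse (by
        intro v hv hv'
        rw [List.mem_reverse] at hv'
        rcases hd v hv (List.mem_cons_of_mem _ hv') with rfl | rfl
        · exact absurd hv' (List.nodup_cons.1 c2).1
        · rfl)
      refine ⟨l, b, hl, (List.isChain_cons_cons.1 c1).1.symm, fun v => ?_⟩
      rw [hm, List.mem_reverse]
      have := h₁.left_mem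
      simp only [List.mem_cons]
      constructor
      · tauto
      · rintro (h | rfl | h | h) <;> tauto

/-- A path from `Z` to `T` contains one all of whose inner vertices avoid `Z` and `T`. -/
lemma exists_bridge (h : PathList G l x y) {Z T : Set V} (hx : x ∈ Z) (hy : y ∈ T) :
    ∃ l' x' y', PathList G l' x' y' ∧ x' ∈ Z ∧ y' ∈ T ∧ (∀ v ∈ l', v ∈ l) ∧
      (∀ v ∈ l', v ∈ Z → v = x') ∧ ∀ v ∈ l', v ∈ T → v = y' := by
  induction hn : l.length using Nat.strong_induction_on generalizing l x y with
  | _ n ih =>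
  by_cases h1 : ∃ v ∈ l, v ∈ Z ∧ v ≠ x
  · obtain ⟨v, hv, hvZ, hvx⟩ := h1
    obtain ⟨l₁, l₂, rfl⟩ := List.append_of_mem hv
    have hne : l₁ ≠ [] := by rintro rfl; exact hvx h.eq_of_cons
    have hlen : 0 < l₁.length := List.length_pos_iff.2 hne
    obtain ⟨l', x', y', h', a, b, c, d, e⟩ := ih (v :: l₂).length
      (by rw [← hn]; simp; omega) h.right_of_append_cons hvZ hy rfl
    exact ⟨l', x', y', h', a, b, fun u hu => List.mem_append_right _ (c u hu), d, e⟩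
  by_cases h2 : ∃ v ∈ l, v ∈ T ∧ v ≠ y
  · obtain ⟨v, hv, hvT, hvy⟩ := h2
    obtain ⟨l₁, l₂, rfl⟩ := List.append_of_mem hv
    have hne : l₂ ≠ [] := by
      rintro rfl
      have := h.2.2.2
      simp at this
      exact hvy this
    have hlen : 0 < l₂.length := List.length_pos_iff.2 hne
    obtain ⟨l', x', y', h', a, b, c, d, e⟩ := ih (l₁ ++ [v]).length
      (by rw [← hn]; simp; omega) h.left_of_append_cons hx hvT rfl
    exact ⟨l', x', y', h', a, b, fun u hu => by
      have := c u hu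
      simp at this ⊢
      tauto, d, e⟩
  push Not at h1 h2
  exact ⟨l, x, y, h, hx, hy, fun _ hv => hv, h1, h2⟩

end PathList

/-! ### Disjoint paths and rerouting. -/

section Fan

lemma List.mem_append_cons_of_mem_append_singleton {α : Type*} {l₁ l₂ : List α} {z v : α}
    (h : v ∈ l₁ ++ [z]) : v ∈ l₁ ++ z :: l₂ := by
  simp at h ⊢
  tauto

variable {V : Type*} {G : SimpleGraph V}

/-- The fan lemma: given a path `M ++ w :: B` from `u ∈ S` that is otherwise disjoint from `S`,
there are two disjoint paths from `S` to `w :: B`, one of them starting at `u` and one of them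
ending at `w`. -/
lemma NoCutVertex.exists_disjoint_paths (hG : NoCutVertex G) {S : Set V} {u a : V} (hu : u ∈ S)
    (ha : a ∈ S) (hau : a ≠ u) (M : List V) : ∀ (w : V) (B : List V) (y : V), B ≠ [] →
    PathList G (M ++ w :: B) u y → (∀ v ∈ M ++ w :: B, v ∈ S → v = u) →
    ∃ Q Q' s s' b, PathList G Q s w ∧ PathList G Q' s' b ∧ s ∈ S ∧ s' ∈ S ∧ (s = u ∨ s' = u) ∧
      b ∈ B ∧ (∀ v ∈ Q, v ∉ Q') ∧ (∀ v ∈ Q, v ∈ S → v = s) ∧ (∀ v ∈ Q, v ∈ w :: B → v = w) ∧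
      (∀ v ∈ Q', v ∈ S → v = s') ∧ ∀ v ∈ Q', v ∈ w :: B → v = b := by
  -- The pair of paths is updated as `w` moves one vertex along the given path, starting from `w =
  -- u`.
  induction M using List.reverseRecOn with
  | nil =>
    intro w B y hB hP hS
    obtain rfl : w = u := hP.eq_of_cons
    have hyB : y ∈ B := by
      have := hP.2.2.2
      rw [List.nil_append, List.getLast?_cons_of_ne_nil hB] at this
      exact List.mem_of_mem_getLast? (by simp [this])
    have hwB : w ∉ B := (List.nodup_cons.1 hP.2.1).1
    obtain ⟨l, hl, hwl⟩ := hG w a y hau (fun h => hwB (h ▸ hyB))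
    obtain ⟨R, s, t, hR, hs, ht, hRl, hRS, hRT⟩ := hl.exists_bridge (Z := S) (T := {v | v ∈ B}) ha hyB
    have hwR : w ∉ R := fun h => hwl (hRl w h)
    refine ⟨[w], R, w, s, t, .single w, hR, hu, hs, .inl rfl, ht, ?_, ?_, ?_, hRS, ?_⟩
    · simpa using hwR
    · simp
    · simp
    · intro v hv hvB
      rcases List.mem_cons.1 hvB with rfl | h
      · exact absurd hv hwR
      · exact hRT v hv h
  | append_singleton M w₀ ih =>
    intro w B y hB hP hS
    have e : M ++ [w₀] ++ w :: B = M ++ w₀ :: w :: B := by simp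
    rw [e] at hP hS
    have hP₀ := hP.right_of_append_cons
    have hadj : G.Adj w₀ w := (List.isChain_cons_cons.1 hP₀.1).1
    have hw₀ : w₀ ∉ w :: B := (List.nodup_cons.1 hP₀.2.1).1
    have hwB : w ∉ B := (List.nodup_cons.1 (List.nodup_cons.1 hP₀.2.1).2).1
    have hwu : w ≠ u := by
      rintro rfl
      cases M with
      | nil => exact hw₀ (by simp [hP.eq_of_cons])
      | cons c M =>
        obtain rfl := hP.eq_of_cons
        have := (List.nodup_cons.1 hP.2.1).1
        simp at this
    have hwS : w ∉ S := fun h => hwu (hS w (by simp) h)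
    have hBS : ∀ v ∈ B, v ∉ S := by
      intro v hv h
      obtain rfl := hS v (by simp [hv]) h
      cases M with
      | nil => exact hw₀ (by simp [hP.eq_of_cons, hv])
      | cons c M =>
        obtain rfl := hP.eq_of_cons
        have := (List.nodup_cons.1 hP.2.1).1
        simp [hv] at this
    obtain ⟨Q, Q', s, s', b, hQ, hQ', hs, hs', hu', hb, hd, hQS, hQw, hQS', hQw'⟩ :=
      ih w₀ (w :: B) y (by simp) hP hS
    have hwQ : w ∉ Q := fun h => hw₀ (by
      have := hQw w h (by simp)
      simp [this])
    have hBQ : ∀ v ∈ B, v ∉ Q := fun v hv h => hw₀ (by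
      have := hQw v h (by simp [hv])
      simp [← this, hv])
    have hQc := hQ.concat hadj hwQ
    by_cases hbw : b = w
    · subst hbw
      have hBQ' : ∀ v ∈ B, v ∉ Q' := fun v hv h => hwB (by
        have := hQw' v h (by simp [hv])
        rwa [← this])
      have hyB : y ∈ B := by
        have := hP₀.right_of_append_cons (l₁ := [w₀])
        have := this.2.2.2
        rw [List.getLast?_cons_of_ne_nil hB] at this
        exact List.mem_of_mem_getLast? (by simp [this])
      -- Here `Q'` already ends at the new `w`, so a second path into `B` is needed. A path `R`
      -- avoiding `w` leaves `S ∪ Q ∪ Q'` at `z`. If `z` is on `Q` or `Q'`, that path is diverted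
      -- along `R`, and the other one ends at `w`. Otherwise `R` itself is used, together with
      -- whichever of the two paths starts at `u`.
      obtain ⟨l, hl, hwl⟩ := hG b w₀ y hadj.ne (fun h => hwB (h ▸ hyB))
      obtain ⟨R, z, t, hR, hz, ht, hRl, hRZ, hRT⟩ := hl.exists_bridge
        (Z := {v | v ∈ S ∨ v ∈ Q ∨ v ∈ Q'}) (T := {v | v ∈ B}) (.inr (.inl hQ.right_mem)) hyB
      have hwR : b ∉ R := fun h => hwl (hRl b h)
      simp only [Set.mem_ofPred_eq] at hz ht hRZ hRT
      by_cases hzQ : z ∈ Q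
      · obtain ⟨α, β, rfl⟩ := List.append_of_mem hzQ
        obtain ⟨N, hN, hNm⟩ := hQ.left_of_append_cons.glue hR (fun v hv hv' => hRZ v hv'
          (.inr (.inl (List.mem_append_cons_of_mem_append_singleton hv))))
        have hNm' : ∀ v ∈ N, v ∈ α ++ z :: β ∨ v ∈ R := fun v hv => 
          ((hNm v).1 hv).imp_left List.mem_append_cons_of_mem_append_singleton
        refine ⟨Q', N, s', s, t, hQ', hN, hs', hs, hu'.symm, ht, ?_, hQS', ?_, ?_, ?_⟩
        · intro v hv hvN
          rcases hNm' v hvN with h | h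
          · exact hd v h hv
          · obtain rfl := hRZ v h (.inr (.inr hv))
            exact hd v hzQ hv
        · exact fun v hv h => hQw' v hv (List.mem_cons_of_mem _ h)
        · intro v hv hvS
          rcases hNm' v hv with h | h
          · exact hQS v h hvS
          · obtain rfl := hRZ v h (.inl hvS)
            exact hQS v hzQ hvS
        · intro v hv hvB
          rcases hNm' v hv with h | h
          · rcases List.mem_cons.1 hvB with rfl | h'
            · exact absurd h hwQ
            · exact absurd h (hBQ v h')
          · rcases List.mem_cons.1 hvB with rfl | h'
            · exact absurd h hwR
            · exact hRT v h h'
      by_cases hzQ' : z ∈ Q'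
      · obtain ⟨α, β, rfl⟩ := List.append_of_mem hzQ'
        have hzb : z ≠ b := fun h => hwR (h ▸ hR.left_mem)
        have hbα : b ∉ α ++ [z] := by
          intro h
          have hβ : b ∈ z :: β := hQ'.right_of_append_cons.right_mem
          have h1 := List.nodup_append.1 hQ'.2.1
          simp at h hβ
          rcases h with h | h
          · exact h1.2.2 b h b (by simp [hβ]) rfl
          · exact hzb h.symm
        obtain ⟨N, hN, hNm⟩ := hQ'.left_of_append_cons.glue hR (fun v hv hv' => hRZ v hv'
          (.inr (.inr (List.mem_append_cons_of_mem_append_singleton hv))))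
        have hNm' : ∀ v ∈ N, (v ∈ α ++ z :: β ∧ v ≠ b) ∨ v ∈ R := fun v hv => by
          rcases (hNm v).1 hv with h | h
          · left
            refine ⟨List.mem_append_cons_of_mem_append_singleton h, ?_⟩
            rintro rfl; exact hbα h
          · exact .inr h
        refine ⟨Q ++ [b], N, s, s', t, hQc, hN, hs, hs', hu', ht, ?_, ?_, ?_, ?_, ?_⟩
        · intro v hv hvN
          rcases hNm' v hvN with h | h
          · rcases List.mem_append.1 hv with h' | h'
            · exact hd v h' h.1
            · exact h.2 (by simpa using h')
          · rcases List.mem_append.1 hv with h' | h'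
            · obtain rfl := hRZ v h (.inr (.inl h'))
              exact hzQ h'
            · obtain rfl : v = b := by simpa using h'
              exact hwR h
        · intro v hv hvS
          rcases List.mem_append.1 hv with h' | h'
          · exact hQS v h' hvS
          · obtain rfl : v = b := by simpa using h'
            exact absurd hvS hwS
        · intro v hv hvB
          rcases List.mem_append.1 hv with h' | h'
          · rcases List.mem_cons.1 hvB with rfl | h
            · rfl
            · exact absurd h' (hBQ v h)
          · simpa using h'
        · intro v hv hvS
          rcases hNm' v hv with h | h
          · exact hQS' v h.1 hvS
          · obtain rfl := hRZ v h (.inl hvS)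
            exact hQS' v hzQ' hvS
        · intro v hv hvB
          rcases hNm' v hv with h | h
          · rcases List.mem_cons.1 hvB with rfl | h'
            · exact absurd rfl h.2
            · exact absurd h.1 (hBQ' v h')
          · rcases List.mem_cons.1 hvB with rfl | h'
            · exact absurd h hwR
            · exact hRT v h h'
      · have hzS : z ∈ S := hz.resolve_right (by simp [hzQ, hzQ'])
        have hRB : ∀ v ∈ R, v ∈ b :: B → v = t := by
          intro v h hvB
          rcases List.mem_cons.1 hvB with rfl | h'
          · exact absurd h hwR
          · exact hRT v h h'
        rcases hu' with rfl | rfl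
        · refine ⟨Q ++ [b], R, s, z, t, hQc, hR, hs, hzS, .inl rfl, ht, ?_, ?_, ?_,
            fun v hv h => hRZ v hv (.inl h), hRB⟩
          · intro v hv h
            rcases List.mem_append.1 hv with h' | h'
            · obtain rfl := hRZ v h (.inr (.inl h'))
              exact hzQ h'
            · obtain rfl : v = b := by simpa using h'
              exact hwR h
          · intro v hv hvS
            rcases List.mem_append.1 hv with h' | h'
            · exact hQS v h' hvS
            · obtain rfl : v = b := by simpa using h'
              exact absurd hvS hwS
          · intro v hv hvB
            rcases List.mem_append.1 hv with h' | h'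
            · rcases List.mem_cons.1 hvB with rfl | h
              · rfl
              · exact absurd h' (hBQ v h)
            · simpa using h'
        · refine ⟨Q', R, s', z, t, hQ', hR, hs', hzS, .inl rfl, ht, ?_, hQS',
            fun v hv h => hQw' v hv (List.mem_cons_of_mem _ h),
            fun v hv h => hRZ v hv (.inl h), hRB⟩
          intro v hv h
          obtain rfl := hRZ v h (.inr (.inr hv))
          exact hzQ' hv
    · have hbB : b ∈ B := (List.mem_cons.1 hb).resolve_left hbw
      refine ⟨Q ++ [w], Q', s, s', b, hQc, hQ', hs, hs', hu', hbB, ?_, ?_, ?_, hQS', ?_⟩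
      · intro v hv hv'
        rcases List.mem_append.1 hv with h | h
        · exact hd v h hv'
        · obtain rfl : v = w := by simpa using h
          exact hbw (hQw' v hv' (by simp)).symm
      · intro v hv hvS
        rcases List.mem_append.1 hv with h' | h'
        · exact hQS v h' hvS
        · obtain rfl : v = w := by simpa using h'
          exact absurd hvS hwS
      · intro v hv hvB
        rcases List.mem_append.1 hv with h' | h'
        · rcases List.mem_cons.1 hvB with rfl | h
          · rfl
          · exact absurd h' (hBQ v h)
        · simpa using h'
      · exact fun v hv h => hQw' v hv (List.mem_cons_of_mem _ h)

/-- If the ends of a path are adjacent, the path can be rerouted to start at any inner vertex `a`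
while keeping its first vertex and all neighbours of its first vertex. -/
lemma PathList.exists_reroute {l : List V} {x u a : V} (h : PathList G l x u) (hxu : G.Adj x u)
    (ha : a ∈ l) (hau : a ≠ u) :
    ∃ l', PathList G l' a u ∧ (∀ v ∈ l', v ∈ l) ∧ x ∈ l' ∧ ∀ v ∈ l, G.Adj x v → v ∈ l' := by
  obtain ⟨l₁, l₂, rfl⟩ := List.append_of_mem ha
  have hne : l₂ ≠ [] := by
    rintro rfl
    have := h.2.2.2
    simp at this
    exact hau this
  have hu : u ∈ l₂ := by
    have := h.2.2.2
    rw [List.getLast?_append_of_ne_nil _ (by simp), List.getLast?_cons_of_ne_nil hne] at this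
    exact List.mem_of_mem_getLast? (by simp [this])
  -- `c` is the first neighbour of `x` after `a`. The new path runs from `a` back to `x`, jumps to
  -- `c` and continues to `u`; the skipped stretch `A` contains no neighbour of `x`.
  obtain ⟨A, c, C, rfl, hc, hA⟩ : ∃ A c C, l₂ = A ++ c :: C ∧ G.Adj x c ∧ ∀ v ∈ A, ¬ G.Adj x v := by
    clear h ha hne
    induction l₂ with
    | nil => simp at hu
    | cons d l ih =>
      by_cases hd : G.Adj x d
      · exact ⟨[], d, l, rfl, hd, by simp⟩
      · have : u ∈ l := by
          rcases List.mem_cons.1 hu with rfl | h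
          · exact absurd hxu hd
          · exact h
        obtain ⟨A, c, C, rfl, hc, hA⟩ := ih this
        refine ⟨d :: A, c, C, rfl, hc, ?_⟩
        simpa [hd] using hA
  have h1 := h.left_of_append_cons.reverse
  have h2 : PathList G (c :: C) c u :=
    PathList.right_of_append_cons (l₁ := l₁ ++ a :: A) (by simpa using h)
  refine ⟨_, h1.append h2 hc ?_, ?_, ?_, ?_⟩
  · intro v hv hv'
    have := h.2.1
    rw [show l₁ ++ a :: (A ++ c :: C) = (l₁ ++ [a]) ++ A ++ (c :: C) by simp,
      List.append_assoc, List.nodup_append] at this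
    exact this.2.2 v (by simpa [or_comm] using hv) v (by simp at hv' ⊢; tauto) rfl
  · intro v hv
    simp at hv ⊢
    tauto
  · exact List.mem_append_left _ h1.right_mem
  · intro v hv hxv
    have := hA v
    simp at hv ⊢
    tauto

end Fan

/-! ### Pósa's lemma on the degrees of the ends of a long path. -/

section Posa

variable {V : Type*} {G : SimpleGraph V}

lemma List.Nodup.card_filter_toFinset {α : Type*} [DecidableEq α] {l : List α} (h : l.Nodup)
    (p : α → Prop) [DecidablePred p] : (l.toFinset.filter p).card = l.countP (p ·) := by
  rw [List.countP_eq_length_filter, ← List.toFinset_card_of_nodup (h.filter _),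
    List.toFinset_filter]
  simp

/-- If no `q`-element of `l` is directly followed by a `p`-element, there are few such elements. -/
lemma List.countP_add_countP_le {α : Type*} (p q : α → Prop) [DecidablePred p] [DecidablePred q]
    (l : List α) : ∀ a b, l.head? = some a → l.getLast? = some b →
    (∀ l₁ l₂ c d, l = l₁ ++ c :: d :: l₂ → q c → ¬ p d) →
    l.countP (p ·) + l.countP (q ·) + 1 ≤
      l.length + (if p a then 1 else 0) + (if q b then 1 else 0) := by
  -- Each of the `length - 1` consecutive pairs carries at most one of "first is `q`", "second is
  -- `p`"; the indicators account for `p` at the head and `q` at the last entry.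
  induction l with
  | nil => simp
  | cons c l ih =>
    intro a b ha hb h
    obtain rfl : c = a := by simpa using ha
    cases l with
    | nil =>
      obtain rfl : c = b := by simpa using hb
      simp only [List.countP_cons, List.countP_nil, List.length_cons, List.length_nil,
        decide_eq_true_eq]
      omega
    | cons d l =>
      have := ih d b (by simp) (by simpa using hb)
        (fun l₁ l₂ e f he => h (c :: l₁) l₂ e f (by simp [he]))
      have hcd := h [] l c d rfl
      rw [List.countP_cons, List.countP_cons (l := d :: l), List.length_cons (a := c)]
      simp only [decide_eq_true_eq] at this ⊢
      by_cases h1 : q c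
      · simp [hcd h1, h1] at this ⊢
        omega
      · by_cases h2 : p d <;> simp [h1, h2] at this ⊢ <;> omega

lemma List.exists_last_of_exists {α : Type*} (p : α → Prop) (l : List α) (h : ∃ a ∈ l, p a) :
    ∃ l₁ a l₂, l = l₁ ++ a :: l₂ ∧ p a ∧ ∀ b ∈ l₂, ¬ p b := by
  induction l with
  | nil => simp at h
  | cons c l ih =>
    by_cases hl : ∃ a ∈ l, p a
    · obtain ⟨l₁, a, l₂, rfl, ha, hb⟩ := ih hl
      exact ⟨c :: l₁, a, l₂, rfl, ha, hb⟩
    · push Not at hl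
      refine ⟨[], c, l, rfl, ?_, hl⟩
      obtain ⟨a, ha, hpa⟩ := h
      rcases List.mem_cons.1 ha with rfl | h'
      · exact hpa
      · exact absurd hpa (hl a h')

lemma List.exists_first_of_exists {α : Type*} (p : α → Prop) (l : List α) (h : ∃ a ∈ l, p a) :
    ∃ l₁ a l₂, l = l₁ ++ a :: l₂ ∧ p a ∧ ∀ b ∈ l₁, ¬ p b := by
  obtain ⟨l₁, a, l₂, e, ha, hb⟩ := List.exists_last_of_exists p l.reverse (by simpa using h)
  refine ⟨l₂.reverse, a, l₁.reverse, ?_, ha, by simpa using hb⟩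
  rw [← List.reverse_reverse l, e]
  simp

/-- A list in which some `q`-element comes before some `p`-element contains a closest such pair. -/
lemma List.exists_minimal_gap {α : Type*} (p q : α → Prop) (n : ℕ) : ∀ (l₁ M l₂ : List α) (b c : α),
    M.length ≤ n → q b → p c →
    ∃ l₁' M' l₂' b' c', l₁ ++ b :: (M ++ c :: l₂) = l₁' ++ b' :: (M' ++ c' :: l₂') ∧ q b' ∧ p c' ∧
      ∀ v ∈ M', ¬ p v ∧ ¬ q v := by
  induction n with
  | zero =>
    intro l₁ M l₂ b c hM hb hc
    refine ⟨l₁, M, l₂, b, c, rfl, hb, hc, ?_⟩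
    have : M = [] := List.length_eq_zero_iff.1 (by omega)
    simp [this]
  | succ n ih =>
    intro l₁ M l₂ b c hM hb hc
    by_cases h : ∀ v ∈ M, ¬ p v ∧ ¬ q v
    · exact ⟨l₁, M, l₂, b, c, rfl, hb, hc, h⟩
    · push Not at h
      obtain ⟨v, hv, hpq⟩ := h
      obtain ⟨M₁, M₂, rfl⟩ := List.append_of_mem hv
      simp at hM
      by_cases hpv : p v
      · have := ih l₁ M₁ (M₂ ++ c :: l₂) b v (by omega) hb hpv
        simpa using this
      · have := ih (l₁ ++ b :: M₁) M₂ l₂ v c (by omega) (hpq hpv) hc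
        simpa using this

open Classical in
/-- The case of Pósa's lemma in which the neighbourhoods of the ends of the path cross. -/
lemma CycleListsShort.countP_lt_of_crossing {k : ℕ} (hs : CycleListsShort G k) (hk : 3 ≤ k)
    {l₁ M l₂ : List V} {x y b c : V} (hP : PathList G (l₁ ++ b :: (M ++ c :: l₂)) x y)
    (hlen : k ≤ (l₁ ++ b :: (M ++ c :: l₂)).length) (hb : G.Adj y b) (hc : G.Adj x c) :
    (l₁ ++ b :: (M ++ c :: l₂)).countP (G.Adj x ·) +
      (l₁ ++ b :: (M ++ c :: l₂)).countP (G.Adj y ·) < k := by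
  obtain ⟨l₁, M, l₂, b, c, e, hb, hc, hM⟩ :=
    List.exists_minimal_gap (G.Adj x) (G.Adj y) M.length l₁ M l₂ b c le_rfl hb hc
  rw [e] at hP hlen ⊢
  -- The cycle goes from `x` to `b`, jumps to `y`, runs back to `c` and closes at `x`, omitting only
  -- `M`.
  have hcyc : ∀ (l₁ M l₂ : List V) b c, PathList G (l₁ ++ b :: (M ++ c :: l₂)) x y → G.Adj y b →
      G.Adj x c → (l₁ ++ [b]).length + (c :: l₂).length < k := by
    intro l₁ M l₂ b c hP hb hc
    have h1 := hP.left_of_append_cons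
    have h2 : PathList G (c :: l₂) c y :=
      PathList.right_of_append_cons (l₁ := l₁ ++ b :: M) (by simpa using hP)
    have h3 := h1.append h2.reverse hb.symm (by
      intro v hv hv'
      have := hP.2.1
      rw [show l₁ ++ b :: (M ++ c :: l₂) = (l₁ ++ [b]) ++ M ++ (c :: l₂) by simp,
        List.append_assoc, List.nodup_append] at this
      exact this.2.2 v hv v (by simp at hv' ⊢; tauto) rfl)
    by_cases h4 : 3 ≤ (l₁ ++ [b] ++ (c :: l₂).reverse).length
    · have := hs _ _ _ h3 h4 hc.symm
      simp at this ⊢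
      omega
    · simp at h4 ⊢
      omega
  by_cases hM0 : M = []
  · subst hM0
    have := hcyc l₁ [] l₂ b c hP hb hc
    simp at this hlen
    omega
  have hMpos := List.length_pos_iff.2 hM0
  -- A crossing at consecutive vertices would give a cycle through the whole path.
  have hno : ∀ m₁ m₂ d e, l₁ ++ b :: (M ++ c :: l₂) = m₁ ++ d :: e :: m₂ → G.Adj y d →
      ¬ G.Adj x e := by
    intro m₁ m₂ d e h hd he
    rw [h] at hP hlen
    have := hcyc m₁ [] m₂ d e hP hd he
    simp at this hlen
    omega
  -- On each outer segment one indicator is 1 and the other 0, so the neighbours counted there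
  -- number at most its length. The gap `M` contributes none, and the outer segments together form
  -- the cycle of `hcyc`.
  have h1 := List.countP_add_countP_le (G.Adj x) (G.Adj y) (l₁ ++ [b]) x b
    hP.left_of_append_cons.2.2.1 (by simp) (fun m₁ m₂ d e h => by
      refine hno m₁ (m₂ ++ (M ++ c :: l₂)) d e ?_
      rw [show l₁ ++ b :: (M ++ c :: l₂) = (l₁ ++ [b]) ++ (M ++ c :: l₂) by simp, h]
      simp)
  have h2 := List.countP_add_countP_le (G.Adj x) (G.Adj y) (c :: l₂) c y
    (by simp) (PathList.right_of_append_cons (l₁ := l₁ ++ b :: M) (by simpa using hP)).2.2.2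
    (fun m₁ m₂ d e h => by
      refine hno (l₁ ++ b :: M ++ m₁) m₂ d e ?_
      rw [h]
      simp)
  have h3 := hcyc l₁ M l₂ b c hP hb hc
  have h4 : M.countP (G.Adj x ·) = 0 := by
    rw [List.countP_eq_zero]; simpa using fun v hv => (hM v hv).1
  have h5 : M.countP (G.Adj y ·) = 0 := by
    rw [List.countP_eq_zero]; simpa using fun v hv => (hM v hv).2
  rw [show l₁ ++ b :: (M ++ c :: l₂) = (l₁ ++ [b]) ++ M ++ (c :: l₂) by simp,
    List.countP_append (l₁ := l₁ ++ [b] ++ M), List.countP_append (l₁ := l₁ ++ [b] ++ M),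
    List.countP_append (l₁ := l₁ ++ [b]), List.countP_append (l₁ := l₁ ++ [b]), h4, h5]
  simp only [SimpleGraph.irrefl, hb, hc, if_true, if_false] at h1 h2
  omega

open Classical in
/-- **Pósa's lemma**: in a graph without cut vertices, a path on at least `k` vertices whose ends
have at least `k` neighbours on it in total forces a cycle on at least `k` vertices. -/
theorem CycleListsShort.countP_lt {k : ℕ} (hs : CycleListsShort G k) (hG : NoCutVertex G)
    (hk : 3 ≤ k) {P : List V} {x y : V} (hP : PathList G P x y) (hlen : k ≤ P.length) :
    P.countP (G.Adj x ·) + P.countP (G.Adj y ·) < k := by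
  by_cases hcr : ∃ l₁ M l₂ b c, P = l₁ ++ b :: (M ++ c :: l₂) ∧ G.Adj y b ∧ G.Adj x c
  · obtain ⟨l₁, M, l₂, b, c, rfl, hb, hc⟩ := hcr
    exact hs.countP_lt_of_crossing hk hP hlen hb hc
  by_contra hcount
  have hx : ∃ v ∈ P, G.Adj x v := by
    rcases P with _ | ⟨a, _ | ⟨b, P⟩⟩
    · simp at hlen; omega
    · simp at hlen; omega
    · obtain rfl := hP.eq_of_cons
      exact ⟨b, by simp, (List.isChain_cons_cons.1 hP.1).1⟩
  -- `u` is the last neighbour of `x`, and `w` below the first neighbour of `y` from `u` on. Without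
  -- a crossing, all neighbours of `y` lie in `w :: B`; possibly `u = w`.
  obtain ⟨A, u, P₂, rfl, hu, hP₂⟩ := List.exists_last_of_exists _ _ hx
  have hA : ∀ v ∈ A, ¬ G.Adj y v := by
    intro v hv hyv
    obtain ⟨A₁, A₂, rfl⟩ := List.append_of_mem hv
    exact hcr ⟨A₁, A₂, P₂, v, u, by simp, hyv, hu⟩
  have hy : ∃ v ∈ u :: P₂, G.Adj y v := by
    have h1 := hP.reverse
    have : ∃ v ∈ (A ++ u :: P₂).reverse, G.Adj y v := by
      rcases hPr : (A ++ u :: P₂).reverse with _ | ⟨a, _ | ⟨b, R⟩⟩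
      · simp at hPr
      · have := congrArg List.length hPr
        simp at this hlen; omega
      · rw [hPr] at h1
        obtain rfl := h1.eq_of_cons
        exact ⟨b, by simp, (List.isChain_cons_cons.1 h1.1).1⟩
    obtain ⟨v, hv, hyv⟩ := this
    rw [List.mem_reverse, List.mem_append] at hv
    exact ⟨v, hv.resolve_left fun h => hA v h hyv, hyv⟩
  obtain ⟨M, w, B, e, hw, hM⟩ := List.exists_first_of_exists _ _ hy
  have hPu : PathList G (M ++ w :: B) u y := e ▸ hP.right_of_append_cons
  have hA0 : A ≠ [] := by
    rintro rfl
    obtain rfl := hP.eq_of_cons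
    exact hu.ne rfl
  have hxA : x ∈ A := by
    obtain ⟨a, A, rfl⟩ := List.exists_cons_of_ne_nil hA0
    simp [PathList.eq_of_cons hP]
  have hB0 : B ≠ [] := by
    rintro rfl
    have := hPu.2.2.2
    simp at this
    exact hw.ne this.symm
  have hnd : ∀ v ∈ A, v ∉ M ++ w :: B := by
    intro v hv hv'
    have := hP.2.1
    rw [e, List.nodup_append] at this
    exact this.2.2 v hv v hv' rfl
  have hxu : x ≠ u := hu.ne
  have hPA : PathList G (A ++ [u]) x u := hP.left_of_append_cons
  have hPB : PathList G (w :: B) w y := hPu.right_of_append_cons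
  obtain ⟨Q, Q', s, s', b, hQ, hQ', hsS, hsS', hsu, hb, hd, hQS, hQw, hQS', hQw'⟩ :=
    hG.exists_disjoint_paths (S := {v | v ∈ A ++ [u]}) (u := u) (a := x) (by simp)
      (by simp [hxA]) hxu M w B y hB0 hPu (by
        intro v hv hvS
        rcases List.mem_append.1 hvS with h | h
        · exact absurd hv (hnd v h)
        · simpa using h)
  simp only [Set.mem_ofPred_eq] at hsS hsS' hQS hQS'
  have hbw : b ≠ w := by
    rintro rfl
    exact (List.nodup_cons.1 hPB.2.1).1 hb
  have hss : s ≠ s' := by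
    rintro rfl
    exact hd s hQ.left_mem hQ'.left_mem
  obtain ⟨TB, hTB, hTBm, hyT, hNy⟩ := hPB.reverse.exists_reroute hw (a := b) (by simp [hb]) hbw
  simp only [List.mem_reverse] at hTBm hNy
  have huw : u ∈ w :: B → u = w := by
    intro h
    cases M with
    | nil => exact (hPu.eq_of_cons).symm
    | cons m M =>
      obtain rfl := hPu.eq_of_cons
      have := (List.nodup_cons.1 hPu.2.1).1
      exact absurd (List.mem_append_right _ h) this
  have hABu : ∀ v ∈ A ++ [u], v ∈ w :: B → v = u ∧ u = w := by
    intro v hv hvB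
    rcases List.mem_append.1 hv with h | h
    · exact absurd (List.mem_append_right _ hvB) (hnd v h)
    · obtain rfl : v = u := by simpa using h
      exact ⟨rfl, huw hvB⟩
  -- Both segments are rerouted to run between the ends of the two disjoint paths: one keeps `x` and
  -- its neighbours, the other `y` and its neighbours. The four pieces form one cycle; the cases
  -- differ in which path starts at `u`.
  have key : ∃ l z z', PathList G l z z' ∧ G.Adj z' z ∧ x ∈ l ∧ y ∈ l ∧
      (∀ v ∈ A ++ [u], G.Adj x v → v ∈ l) ∧ (∀ v ∈ w :: B, G.Adj y v → v ∈ l) := by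
    by_cases hs1 : s = u
    · subst hs1
      obtain ⟨TA, hTA, hTAm, hxT, hNx⟩ := hPA.exists_reroute hu hsS' hss.symm
      obtain ⟨N, hN, hNm⟩ := hTA.glue hQ (fun v hv hv' => hQS v hv' (hTAm v hv))
      obtain ⟨N', hN', hNm'⟩ := hN.glue hTB.reverse (by
        intro v hv hv'
        rw [List.mem_reverse] at hv'
        rcases (hNm v).1 hv with h | h
        · obtain ⟨rfl, h⟩ := hABu v (hTAm v h) (hTBm v hv')
          exact h
        · exact hQw v h (hTBm v hv'))
      have hsb : s' ≠ b := by
        rintro rfl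
        obtain ⟨h1, h2⟩ := hABu s' hsS' (by simp [hb])
        exact hss h1.symm
      obtain ⟨l, z, hl, hadj, hlm⟩ := hN'.exists_cycle hQ' hsb (by
        intro v hv hv'
        rcases (hNm' v).1 hv with h | h
        · rcases (hNm v).1 h with h | h
          · exact .inl (hQS' v hv' (hTAm v h))
          · exact absurd hv' (hd v h)
        · exact .inr (hQw' v hv' (hTBm v (List.mem_reverse.1 h))))
      have hTAl : ∀ v ∈ TA, v ∈ l := fun v h => (hlm v).2 (.inl ((hNm' v).2 (.inl ((hNm v).2 (.inl h)))))
      have hTBl : ∀ v ∈ TB, v ∈ l := fun v h =>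
        (hlm v).2 (.inl ((hNm' v).2 (.inr (List.mem_reverse.2 h))))
      exact ⟨l, s', z, hl, hadj, hTAl _ hxT, hTBl _ hyT, fun v h h' => hTAl v (hNx v h h'),
        fun v h h' => hTBl v (hNy v h h')⟩
    · have hs2 : s' = u := hsu.resolve_left hs1
      subst hs2
      obtain ⟨TA, hTA, hTAm, hxT, hNx⟩ := hPA.exists_reroute hu hsS hss
      have hsw : s ≠ w := by
        rintro rfl
        exact hs1 (hABu s hsS (by simp)).1
      have hs'w : s' ≠ w := by
        rintro rfl
        exact hss (hQS s' hQ.right_mem hsS').symm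
      obtain ⟨N, hN, hNm⟩ := hTA.glue hQ' (fun v hv hv' => hQS' v hv' (hTAm v hv))
      obtain ⟨N', hN', hNm'⟩ := hN.glue hTB (by
        intro v hv hv'
        rcases (hNm v).1 hv with h | h
        · exact absurd (hABu v (hTAm v h) (hTBm v hv')).2 hs'w
        · exact hQw' v h (hTBm v hv'))
      obtain ⟨l, z, hl, hadj, hlm⟩ := hN'.exists_cycle hQ hsw (by
        intro v hv hv'
        rcases (hNm' v).1 hv with h | h
        · rcases (hNm v).1 h with h | h
          · exact .inl (hQS v hv' (hTAm v h))
          · exact absurd h (hd v hv')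
        · exact .inr (hQw v hv' (hTBm v h)))
      have hTAl : ∀ v ∈ TA, v ∈ l := fun v h => (hlm v).2 (.inl ((hNm' v).2 (.inl ((hNm v).2 (.inl h)))))
      have hTBl : ∀ v ∈ TB, v ∈ l := fun v h => (hlm v).2 (.inl ((hNm' v).2 (.inr h)))
      exact ⟨l, s, z, hl, hadj, hTAl _ hxT, hTBl _ hyT, fun v h h' => hTAl v (hNx v h h'),
        fun v h h' => hTBl v (hNy v h h')⟩
  obtain ⟨l, z, z', hl, hadj, hxl, hyl, hXl, hYl⟩ := key
  have hxN : x ∉ w :: B := fun h => hnd x hxA (List.mem_append_right _ h)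
  -- The neighbourhoods share at most `u`, so the cycle has at least `k - 1` neighbours, plus `x`
  -- and `y`.
  have hcard : k + 1 ≤ l.length := by
    rw [← List.toFinset_card_of_nodup hl.2.1]
    rw [← hP.2.1.card_filter_toFinset, ← hP.2.1.card_filter_toFinset] at hcount
    set X := (A ++ u :: P₂).toFinset.filter (G.Adj x)
    set Y := (A ++ u :: P₂).toFinset.filter (G.Adj y)
    have hX : ∀ v ∈ X, v ∈ A ++ [u] ∧ G.Adj x v := by
      intro v hv
      simp only [X, Finset.mem_filter, List.mem_toFinset, List.mem_append, List.mem_cons] at hv ⊢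
      have := hP₂ v
      tauto
    have hY : ∀ v ∈ Y, v ∈ w :: B ∧ G.Adj y v := by
      intro v hv
      simp only [Y, Finset.mem_filter, List.mem_toFinset, e, List.mem_append] at hv
      have := hA v
      have := hM v
      tauto
    have hXY : X ∩ Y ⊆ {u} := by
      intro v hv
      rw [Finset.mem_inter] at hv
      simpa using (hABu v (hX v hv.1).1 (hY v hv.2).1).1
    have hxXY : x ∉ X ∪ Y := by
      intro h
      rcases Finset.mem_union.1 h with h | h
      · exact (hX x h).2.ne rfl
      · exact hxN (hY x h).1
    have hyXY : y ∉ X ∪ Y := by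
      intro h
      rcases Finset.mem_union.1 h with h | h
      · have h1 := hX y h
        exact hcr (by
          obtain ⟨h2, h3⟩ := hABu y h1.1 hPB.right_mem
          exact absurd (h2.trans h3) hw.ne)
      · exact (hY y h).2.ne rfl
    have hxy : x ≠ y := by
      rintro rfl
      exact hxN hPB.right_mem
    have hsub : insert x (insert y (X ∪ Y)) ⊆ l.toFinset := by
      intro v hv
      rw [Finset.mem_insert, Finset.mem_insert, Finset.mem_union] at hv
      rw [List.mem_toFinset]
      rcases hv with rfl | rfl | h | h
      · exact hxl
      · exact hyl
      · exact hXl v (hX v h).1 (hX v h).2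
      · exact hYl v (hY v h).1 (hY v h).2
    have h1 := Finset.card_le_card hsub
    rw [Finset.card_insert_of_notMem (by simp [hxy, Finset.mem_union] at hxXY ⊢; tauto),
      Finset.card_insert_of_notMem hyXY] at h1
    have h2 := Finset.card_union_add_card_inter X Y
    have h3 := Finset.card_le_card hXY
    simp at h3
    omega
  have := hs l z z' hl (by omega) hadj
  omega

end Posa

/-! ### Edge-maximal graphs without long cycles. -/

section Saturated

variable {V : Type*} {G G' : SimpleGraph V}

lemma PathList.mono {l : List V} {x y : V} (h : PathList G l x y) (hle : G ≤ G') :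
    PathList G' l x y :=
  ⟨h.1.imp fun _ _ hab => hle hab, h.2⟩

lemma NoCutVertex.mono (h : NoCutVertex G) (hle : G ≤ G') : NoCutVertex G' := by
  intro v a b ha hb
  obtain ⟨l, hl, hv⟩ := h v a b ha hb
  exact ⟨l, hl.mono hle, hv⟩

lemma SimpleGraph.Walk.IsPath.pathList {x y : V} {p : G.Walk x y} (h : p.IsPath) :
    PathList G p.support x y := by
  refine ⟨p.isChain_adj_support, h.support_nodup, ?_, ?_⟩
  · rw [List.head?_eq_some_head p.support_ne_nil]; simp
  · rw [List.getLast?_eq_some_getLast p.support_ne_nil]; simp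

lemma IsTwoConnected.noCutVertex [Fintype V] (h : IsTwoConnected G) : NoCutVertex G := by
  intro v a b ha hb
  obtain ⟨p⟩ := (h.2.2 v).preconnected ⟨a, by simpa using ha⟩ ⟨b, by simpa using hb⟩
  classical
  let q := p.toPath.1.map (SimpleGraph.Embedding.induce (G := G) _).toHom
  have hq : q.IsPath := p.toPath.2.map (SimpleGraph.Embedding.induce (G := G) _).injective
  refine ⟨q.support, hq.pathList, ?_⟩
  intro hv
  rw [SimpleGraph.Walk.support_map, List.mem_map] at hv
  obtain ⟨u, -, hu⟩ := hv
  exact u.2 hu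

lemma PathList.exists_walk {l : List V} {x y : V} (h : PathList G l x y) :
    ∃ p : G.Walk x y, p.support = l := by
  obtain ⟨h1, h2, h3, h4⟩ := h
  have hne : l ≠ [] := by rintro rfl; simp at h3
  have e1 : l.head hne = x := by
    rw [List.head?_eq_some_head hne] at h3; simpa using h3
  have e2 : l.getLast hne = y := by
    rw [List.getLast?_eq_some_getLast hne] at h4; simpa using h4
  subst e1 e2
  exact ⟨SimpleGraph.Walk.ofSupport l hne h1, by simp⟩

lemma LongCycleFree.cycleListsShort {k : ℕ} (h : LongCycleFree G k) : CycleListsShort G k := by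
  intro l x y hl h3 hyx
  obtain ⟨p, rfl⟩ := hl.exists_walk
  have hp : p.IsPath := by
    rw [SimpleGraph.Walk.isPath_def]; exact hl.2.1
  have hlen := p.length_support
  have hc : (SimpleGraph.Walk.cons hyx p).IsCycle := by
    rw [SimpleGraph.Walk.cons_isCycle_iff]
    refine ⟨hp, fun he => ?_⟩
    rw [Sym2.eq_swap] at he
    have := hp.length_eq_one_of_mem_edges he
    omega
  have := h _ _ hc
  rw [SimpleGraph.Walk.length_cons] at this
  omega

/-- `G` has all cycles short, but each missing edge closes a long cycle. -/
def SaturatedFor (G : SimpleGraph V) (k : ℕ) : Prop :=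
  CycleListsShort G k ∧
    ∀ x y, x ≠ y → ¬ G.Adj x y → ∃ l, PathList G l x y ∧ k ≤ l.length

/-- In an edge-maximal graph, a long cycle created by adding `xy` must use `xy`; removing that edge
leaves a path from `x` to `y` through all vertices of the cycle. -/
lemma CycleListsShort.exists_saturated [Finite V] {k : ℕ} (h : CycleListsShort G k) :
    ∃ G', G ≤ G' ∧ SaturatedFor G' k := by
  obtain ⟨G', hle, hmax⟩ := Finite.exists_le_maximal (p := fun H => CycleListsShort H k) h
  refine ⟨G', hle, hmax.1, fun x y hxy hadj => ?_⟩
  have hnew : ¬ CycleListsShort (G' ⊔ SimpleGraph.edge x y) k := by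
    intro hs
    exact hadj (hmax.2 hs le_sup_left (by simp [SimpleGraph.edge_adj, hxy]))
  have hAdj : ∀ u v, (G' ⊔ SimpleGraph.edge x y).Adj u v →
      ¬ G'.Adj u v → (u = x ∧ v = y) ∨ (u = y ∧ v = x) := by
    intro u v huv hn
    rw [SimpleGraph.sup_adj, SimpleGraph.edge_adj] at huv
    tauto
  have hrev : ∀ u v, ((u = x ∧ v = y) ∨ (u = y ∧ v = x)) →
      ∀ l, PathList G' l u v → k ≤ l.length → ∃ l, PathList G' l x y ∧ k ≤ l.length := by
    rintro u v (⟨rfl, rfl⟩ | ⟨rfl, rfl⟩) l hl hk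
    · exact ⟨l, hl, hk⟩
    · exact ⟨l.reverse, hl.reverse, by simpa using hk⟩
  unfold CycleListsShort at hnew
  push Not at hnew
  obtain ⟨l, a, b, hl, h3, hba, hk⟩ := hnew
  by_cases hc : l.IsChain G'.Adj
  · have hl' : PathList G' l a b := ⟨hc, hl.2⟩
    have hn : ¬ G'.Adj b a := fun h' => by
      have := hmax.1 l a b hl' h3 h'
      omega
    exact hrev a b (hAdj b a hba hn |>.symm.imp And.symm And.symm) l hl' hk
  -- The new edge is an inner pair `c, d`, so the closed list is rotated to start at `d` and end at
  -- `c`.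
  · rw [List.isChain_iff_forall_rel_of_append_cons_cons] at hc
    push Not at hc
    obtain ⟨c, d, l₁, l₂, rfl, hcd⟩ := hc
    have h1 := hl.left_of_append_cons
    have h2 : PathList (G' ⊔ SimpleGraph.edge x y) (d :: l₂) d b :=
      PathList.right_of_append_cons (l₁ := l₁ ++ [c]) (by simpa using hl)
    have hcd' := hAdj c d (List.isChain_cons_cons.1 hl.right_of_append_cons.1).1 hcd
    have hnd := hl.2.1
    rw [show l₁ ++ c :: d :: l₂ = (l₁ ++ [c]) ++ d :: l₂ by simp, List.nodup_append] at hnd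
    have hc2 : c ∉ d :: l₂ := fun h' => hnd.2.2 c (by simp) c h' rfl
    have hd1 : d ∉ l₁ ++ [c] := fun h' => hnd.2.2 d h' d (by simp) rfl
    have hold : ∀ u v, (G' ⊔ SimpleGraph.edge x y).Adj u v →
        ((u ≠ c ∧ v ≠ c) ∨ (u ≠ d ∧ v ≠ d)) → G'.Adj u v := by
      intro u v huv hne
      by_contra hn
      rcases hAdj u v huv hn with ⟨rfl, rfl⟩ | ⟨rfl, rfl⟩ <;>
        rcases hcd' with ⟨rfl, rfl⟩ | ⟨rfl, rfl⟩ <;> simp at hne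
    have h1' : PathList G' (l₁ ++ [c]) a c :=
      ⟨h1.1.imp_of_mem_imp fun u v hu hv huv => hold u v huv
        (.inr ⟨fun e => hd1 (e ▸ hu), fun e => hd1 (e ▸ hv)⟩), h1.2⟩
    have h2' : PathList G' (d :: l₂) d b :=
      ⟨h2.1.imp_of_mem_imp fun u v hu hv huv => hold u v huv
        (.inl ⟨fun e => hc2 (e ▸ hu), fun e => hc2 (e ▸ hv)⟩), h2.2⟩
    have hba' : G'.Adj b a := by
      have hbc : b ≠ c := fun e => hc2 (e ▸ h2.right_mem)
      have had : a ≠ d := fun e => hd1 (e ▸ h1.left_mem)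
      apply hold b a hba
      -- If `a = c`, the closing edge is new only when also `b = d`; the list would then have just
      -- two vertices.
      by_cases hac : a = c
      · right
        refine ⟨?_, had⟩
        rintro rfl
        have e2 : l₂ = [] := by
          by_contra hne
          have := h2.2.2.2
          rw [List.getLast?_cons_of_ne_nil hne] at this
          exact (List.nodup_cons.1 h2.2.1).1 (List.mem_of_mem_getLast? (by simp [this]))
        have e1 : l₁ = [] := by
          cases l₁ with
          | nil => rfl
          | cons e l₁ =>
            obtain rfl := h1.eq_of_cons
            have := (List.nodup_cons.1 h1.2.1).1
            simp [hac] at this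
        subst e1 e2
        simp at h3
      · exact .inl ⟨hbc, hac⟩
    refine hrev d c ?_ _ (h2'.append h1' hba' ?_) ?_
    · rcases hcd' with h' | h'
      · exact .inr h'.symm
      · exact .inl h'.symm
    · intro v hv hv'
      exact hnd.2.2 v hv' v hv rfl
    · simp at hk ⊢
      omega

open Classical in
/-- In a saturated graph without cut vertices, two sets of vertices are completely joined to each
other when the sum of their inner minimum degrees is large. -/
lemma SaturatedFor.adj_of_degrees [Fintype V] {k : ℕ} (h : SaturatedFor G k) (hG : NoCutVertex G)
    (hk : 3 ≤ k) {S T : Finset V} {α β : ℕ} (hS : ∀ x ∈ S, α ≤ (S.filter (G.Adj x)).card)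
    (hT : ∀ y ∈ T, β ≤ (T.filter (G.Adj y)).card) (hαβ : k ≤ α + β) {x y : V} (hx : x ∈ S)
    (hy : y ∈ T) (hxy : x ≠ y) : G.Adj x y := by
  by_contra hadj
  -- A path with nonadjacent ends in `S` and `T` can be lengthened without limit. An end with a
  -- neighbour off the path in its own set is replaced by it, and the new ends are nonadjacent
  -- because all cycles are short. If neither end has such a neighbour, Pósa's lemma is violated.
  have main : ∀ m, ∃ l x y, PathList G l x y ∧ x ∈ S ∧ y ∈ T ∧ x ≠ y ∧ ¬ G.Adj x y ∧ k ≤ l.length ∧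
      m ≤ l.length := by
    intro m
    induction m with
    | zero =>
      obtain ⟨l, hl, hkl⟩ := h.2 x y hxy hadj
      exact ⟨l, x, y, hl, hx, hy, hxy, hadj, hkl, Nat.zero_le _⟩
    | succ m ih =>
      obtain ⟨l, x, y, hl, hx, hy, hxy, hadj, hkl, hm⟩ := ih
      by_cases h1 : ∃ z ∈ S, G.Adj x z ∧ z ∉ l
      · obtain ⟨z, hz, hxz, hzl⟩ := h1
        have hl' := hl.cons hxz.symm hzl
        refine ⟨z :: l, z, y, hl', hz, hy, ?_, ?_, ?_, ?_⟩
        · rintro rfl; exact hzl hl.right_mem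
        · intro hzy
          have := h.1 _ _ _ hl' (by simp; omega) hzy.symm
          simp at this; omega
        · simp; omega
        · simp; omega
      by_cases h2 : ∃ z ∈ T, G.Adj y z ∧ z ∉ l
      · obtain ⟨z, hz, hyz, hzl⟩ := h2
        have hl' := hl.concat hyz hzl
        refine ⟨l ++ [z], x, z, hl', hx, hz, ?_, ?_, ?_, ?_⟩
        · rintro rfl; exact hzl hl.left_mem
        · intro hxz
          have := h.1 _ _ _ hl' (by simp; omega) hxz.symm
          simp at this; omega
        · simp; omega
        · simp; omega
      push Not at h1 h2
      exfalso
      have h3 := h.1.countP_lt hG hk hl hkl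
      rw [← hl.2.1.card_filter_toFinset, ← hl.2.1.card_filter_toFinset] at h3
      have h4 : (S.filter (G.Adj x)).card ≤ (l.toFinset.filter (G.Adj x)).card := by
        apply Finset.card_le_card
        intro v hv
        simp only [Finset.mem_filter, List.mem_toFinset] at hv ⊢
        exact ⟨h1 v hv.1 hv.2, hv.2⟩
      have h5 : (T.filter (G.Adj y)).card ≤ (l.toFinset.filter (G.Adj y)).card := by
        apply Finset.card_le_card
        intro v hv
        simp only [Finset.mem_filter, List.mem_toFinset] at hv ⊢
        exact ⟨h2 v hv.1 hv.2, hv.2⟩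
      have := hS x hx
      have := hT y hy
      omega
  obtain ⟨l, x, y, hl, -, -, -, -, -, hlen⟩ := main (Fintype.card V + 1)
  have := hl.2.1.length_le_card
  omega

lemma exists_pathList_of_clique {l : List V} (hne : l ≠ []) (hnd : l.Nodup)
    (h : ∀ x ∈ l, ∀ y ∈ l, x ≠ y → G.Adj x y) : ∃ x y, PathList G l x y := by
  refine ⟨l.head hne, l.getLast hne, ?_, hnd, List.head?_eq_some_head hne,
    List.getLast?_eq_some_getLast hne⟩
  have h1 : l.IsChain (· ≠ ·) := List.Pairwise.isChain hnd
  exact h1.imp_of_mem_imp fun a b ha hb hab => h a ha b hb hab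

open Classical in
/-- Cliques in a graph without cut vertices and without cycles on `k` or more vertices. -/
lemma CycleListsShort.clique_card_lt [Fintype V] {k : ℕ} (hs : CycleListsShort G k)
    (hG : NoCutVertex G) (hk : 4 ≤ k) (hV : k ≤ Fintype.card V) {C : Finset V}
    (hC : ∀ x ∈ C, ∀ y ∈ C, x ≠ y → G.Adj x y) : C.card + 1 < k := by
  by_contra hcard
  by_cases hall : ∀ v, v ∈ C
  · have e : C = Finset.univ := by ext; simp [hall]
    have hlen : k ≤ C.toList.length := by rw [Finset.length_toList, e]; exact hV
    obtain ⟨x, y, hl⟩ := exists_pathList_of_clique (G := G) (l := C.toList)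
      (by intro h; rw [h] at hlen; simp at hlen; omega) C.nodup_toList (by simpa using hC)
    have hxy : x ≠ y := by
      rintro rfl
      obtain ⟨p, hp⟩ := hl.exists_walk
      have : p.IsPath := by rw [SimpleGraph.Walk.isPath_def, hp]; exact C.nodup_toList
      rw [SimpleGraph.Walk.isPath_iff_nil, ← SimpleGraph.Walk.length_eq_zero_iff] at this
      rw [← hp, SimpleGraph.Walk.length_support] at hlen
      omega
    have := hs _ x y hl (by omega) (hC y (hall y) x (hall x) hxy.symm)
    omega
  push Not at hall
  obtain ⟨v, hv⟩ := hall
  obtain ⟨c, hc, c', hc', hcc⟩ := Finset.one_lt_card.1 (show 1 < C.card by omega)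
  -- Two bridges yield a path through some `z ∉ C` joining distinct `c₁, c₂ ∈ C` and otherwise
  -- avoiding `C`. Closed by a Hamiltonian path of the clique, it gives a cycle on at least `|C| + 1
  -- ≥ k` vertices.
  obtain ⟨l, hl, -⟩ := hG c' v c (by rintro rfl; exact hv hc') hcc
  obtain ⟨R₁, z₁, c₁, hR₁, hz₁, hc₁, -, -, hR₁C⟩ :=
    hl.exists_bridge (Z := {v}) (T := {x | x ∈ C}) (by simp) hc
  obtain rfl : z₁ = v := by simpa using hz₁
  simp only [Set.mem_ofPred_eq] at hc₁ hR₁C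
  obtain ⟨d, hd, hdc⟩ := Finset.exists_mem_ne (show 1 < C.card by omega) c₁
  obtain ⟨l', hl', hcl'⟩ := hG c₁ z₁ d (by rintro rfl; exact hv hc₁) hdc
  obtain ⟨R₂, z, c₂, hR₂, hz, hc₂, hR₂l, hR₂Z, hR₂C⟩ :=
    hl'.exists_bridge (Z := {x | x ∈ R₁}) (T := {x | x ∈ C}) hR₁.left_mem hd
  simp only [Set.mem_ofPred_eq] at hz hc₂ hR₂C hR₂Z
  have hc₁R₂ : c₁ ∉ R₂ := fun h => hcl' (hR₂l _ h)
  have hc₁₂ : c₂ ≠ c₁ := fun h => hc₁R₂ (h ▸ hR₂.right_mem)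
  have hzC : z ∉ C := fun h => hc₁R₂ (hR₁C z hz h ▸ hR₂.left_mem)
  obtain ⟨α, β, rfl⟩ := List.append_of_mem hz
  obtain ⟨N, hN, hNm⟩ := hR₂.reverse.glue hR₁.right_of_append_cons (by
    intro u hu hu'
    exact hR₂Z u (List.mem_reverse.1 hu) (List.mem_append_right _ hu'))
  have hK : ∃ l, PathList G l c₂ c₁ ∧ ∀ u, u ∈ l ↔ u ∈ C := by
    refine ⟨c₂ :: ((C.erase c₂).erase c₁).toList ++ [c₁], ⟨?_, ?_, by simp, by rw [List.getLast?_append]; rfl⟩, ?_⟩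
    · apply List.IsChain.imp_of_mem_imp (R := (· ≠ ·))
      · intro a b ha hb hab
        refine hC a ?_ b ?_ hab
        · simp at ha; rcases ha with rfl | ⟨h1, h2⟩ | rfl <;> tauto
        · simp at hb; rcases hb with rfl | ⟨h1, h2⟩ | rfl <;> tauto
      · apply List.Pairwise.isChain
        change List.Nodup _
        simp [List.nodup_append, Finset.nodup_toList, hc₁₂]
        rintro a h1 h2 h3 rfl; exact h1 rfl
    · simp [List.nodup_append, Finset.nodup_toList, hc₁₂]
      rintro a h1 h2 h3 rfl; exact h1 rfl
    · intro u
      simp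
      by_cases h1 : u = c₂
      · simp [h1, hc₂]
      by_cases h2 : u = c₁
      · simp [h2, hc₁]
      simp [h1, h2]
  obtain ⟨K, hK, hKm⟩ := hK
  obtain ⟨l, w, hl, hadj, hlm⟩ := hN.exists_cycle hK hc₁₂ (by
    intro u hu hu'
    rcases (hNm u).1 hu with h | h
    · exact .inl (hR₂C u (List.mem_reverse.1 h) ((hKm u).1 hu'))
    · exact .inr (hR₁C u (List.mem_append_right _ h) ((hKm u).1 hu')))
  have hsub : insert z C ⊆ l.toFinset := by
    intro u hu
    rw [List.mem_toFinset]
    rcases Finset.mem_insert.1 hu with rfl | h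
    · exact (hlm _).2 (.inl ((hNm _).2 (.inr (by simp))))
    · exact (hlm u).2 (.inr ((hKm u).2 h))
  have h1 := Finset.card_le_card hsub
  rw [Finset.card_insert_of_notMem hzC, List.toFinset_card_of_nodup hl.2.1] at h1
  have := hs l _ w hl (by omega) hadj
  omega

end Saturated

/-! ### Disintegration and edge counting. -/

section Counting

variable {V : Type*} [Fintype V] {G G' : SimpleGraph V}

open Classical in
/-- The number of edges of `G` with both ends in `U`. -/
noncomputable def edgesWithin (G : SimpleGraph V) (U : Finset V) : ℕ :=
  (G.edgeFinset.filter fun e => ∀ v ∈ e, v ∈ U).card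

lemma edgesWithin_univ : edgesWithin G Finset.univ = G.edgeSet.ncard := by
  classical
  rw [edgesWithin, ← SimpleGraph.coe_edgeFinset, Set.ncard_coe_finset]
  simp

open Classical in
lemma edgesWithin_le_erase (U : Finset V) (v : V) :
    edgesWithin G U ≤ edgesWithin G (U.erase v) + (U.filter (G.Adj v)).card := by
  unfold edgesWithin
  refine (Finset.card_le_card (t := (G.edgeFinset.filter fun e => ∀ u ∈ e, u ∈ U.erase v) ∪
    (U.filter (G.Adj v)).image fun w => s(v, w)) ?_).trans
    ((Finset.card_union_le _ _).trans (Nat.add_le_add_left Finset.card_image_le _))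
  intro e
  induction e with
  | _ a b =>
    simp only [Finset.mem_filter, SimpleGraph.mem_edgeFinset, SimpleGraph.mem_edgeSet,
      Sym2.mem_iff, forall_eq_or_imp, forall_eq, Finset.mem_union, Finset.mem_image,
      Finset.mem_erase]
    rintro ⟨hab, ha, hb⟩
    by_cases h1 : a = v
    · subst h1
      exact .inr ⟨b, ⟨hb, hab⟩, rfl⟩
    by_cases h2 : b = v
    · subst h2
      exact .inr ⟨a, ⟨ha, hab.symm⟩, Sym2.eq_swap⟩
    · exact .inl ⟨hab, ⟨h1, ha⟩, h2, hb⟩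

lemma edgesWithin_le_extremalNumber {r : ℕ} (h : G.CliqueFree r) (U : Finset V) :
    edgesWithin G U ≤ SimpleGraph.extremalNumber U.card (⊤ : SimpleGraph (Fin r)) := by
  classical
  have hfree : (⊤ : SimpleGraph (Fin r)).Free (G.induce (U : Set V)) := by
    have h1 := h.comap (SimpleGraph.Embedding.induce (G := G) (U : Set V)).isContained
    have := SimpleGraph.cliqueFree_iff_top_free (G := G.induce (U : Set V)) (β := Fin r)
    rw [Fintype.card_fin] at this
    exact this.1 h1
  have h2 := SimpleGraph.card_edgeFinset_le_extremalNumber hfree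
  rw [show Fintype.card (U : Set V) = U.card by simp] at h2
  refine le_trans ?_ h2
  unfold edgesWithin
  refine (Finset.card_le_card (t := (G.induce (U : Set V)).edgeFinset.image
    (Sym2.map Subtype.val)) ?_).trans Finset.card_image_le
  intro e
  induction e with
  | _ a b =>
    simp only [Finset.mem_filter, SimpleGraph.mem_edgeFinset, SimpleGraph.mem_edgeSet,
      Sym2.mem_iff, forall_eq_or_imp, forall_eq, Finset.mem_image]
    rintro ⟨hab, ha, hb⟩
    exact ⟨s(⟨a, ha⟩, ⟨b, hb⟩), by simpa using hab, by simp⟩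

open Classical in
/-- Every vertex of `K` has more than `d` neighbours in `K`. -/
def MinInnerDegreeGT (G : SimpleGraph V) (d : ℕ) (K : Finset V) : Prop :=
  ∀ x ∈ K, d + 1 ≤ (K.filter (G.Adj x)).card

/-- The condition is preserved by unions, so the union of all such sets is the largest one; it may
be empty. -/
lemma exists_core (G : SimpleGraph V) (d : ℕ) :
    ∃ K, MinInnerDegreeGT G d K ∧ ∀ K', MinInnerDegreeGT G d K' → K' ⊆ K := by
  classical
  refine ⟨Finset.univ.filter fun v => ∃ K, MinInnerDegreeGT G d K ∧ v ∈ K, ?_, ?_⟩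
  · intro x hx
    obtain ⟨K, hK, hxK⟩ := (Finset.mem_filter.1 hx).2
    refine (hK x hxK).trans (Finset.card_le_card (Finset.filter_subset_filter _ ?_))
    intro v hv
    exact Finset.mem_filter.2 ⟨Finset.mem_univ _, K, hK, hv⟩
  · intro K' hK' v hv
    exact Finset.mem_filter.2 ⟨Finset.mem_univ _, K', hK', hv⟩

/-- Deleting vertices of small degree down to a set of size `m` containing the core. -/
lemma exists_subset_edgesWithin_le (hle : G ≤ G') {d : ℕ} {K : Finset V}
    (hK : MinInnerDegreeGT G' d K) (hmax : ∀ K', MinInnerDegreeGT G' d K' → K' ⊆ K) {m : ℕ}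
    (hKm : K.card ≤ m) (n : ℕ) : ∀ U : Finset V, U.card = m + n → K ⊆ U →
    ∃ U', K ⊆ U' ∧ U'.card = m ∧ edgesWithin G U ≤ d * n + edgesWithin G U' := by
  classical
  induction n with
  | zero => exact fun U hU hKU => ⟨U, hKU, hU, by simp⟩
  | succ n ih =>
    intro U hU hKU
    -- `U` is larger than the core, so some vertex has at most `d` `G'`-neighbours in `U`, hence at
    -- most `d` `G`-neighbours. It lies outside `K`.
    have hnot : ¬ MinInnerDegreeGT G' d U := by
      intro h
      have := Finset.card_le_card (hmax U h)
      omega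
    unfold MinInnerDegreeGT at hnot
    push Not at hnot
    obtain ⟨v, hvU, hv⟩ := hnot
    have hvK : v ∉ K := by
      intro h
      have h1 := hK v h
      have h2 := Finset.card_le_card (Finset.filter_subset_filter (G'.Adj v) hKU)
      omega
    obtain ⟨U', hKU', hU', he⟩ := ih (U.erase v)
      (by rw [Finset.card_erase_of_mem hvU]; omega)
      (fun x hx => Finset.mem_erase.2 ⟨fun h => hvK (h ▸ hx), hKU hx⟩)
    refine ⟨U', hKU', hU', ?_⟩
    have h1 := edgesWithin_le_erase (G := G) U v
    have h2 : (U.filter (G.Adj v)).card ≤ (U.filter (G'.Adj v)).card :=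
      Finset.card_le_card (Finset.monotone_filter_right _ fun x _ hx => hle hx)
    rw [Nat.mul_succ]
    omega

/-- The disintegration argument: the number of edges is bounded by one of the values of `gTuran`. -/
theorem exists_ncard_edgeSet_le_gTuran {n k r : ℕ} (hk : 5 ≤ k) (hkn : k ≤ n)
    (hV : Fintype.card V = n) (hG : IsTwoConnected G) (hr : G.CliqueFree r)
    (hcyc : LongCycleFree G k) :
    ∃ a, 2 ≤ a ∧ a ≤ (k - 1) / 2 ∧ G.edgeSet.ncard ≤ gTuran r n a k := by
  classical
  obtain ⟨G', hle, hsat⟩ := hcyc.cycleListsShort.exists_saturated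
  have hG' : NoCutVertex G' := hG.noCutVertex.mono hle
  rw [← edgesWithin_univ]
  obtain ⟨t, ht⟩ : ∃ t, t = (k - 1) / 2 := ⟨_, rfl⟩
  rw [← ht]
  obtain ⟨K, hK, hKmax⟩ := exists_core G' t
  by_cases hK0 : K = ∅
  · obtain ⟨U', -, hU', he⟩ := exists_subset_edgesWithin_le hle hK hKmax (m := k - t) (by simp [hK0])
      (n - k + t) Finset.univ (by rw [Finset.card_univ, hV]; omega) (Finset.subset_univ _)
    refine ⟨t, by omega, le_rfl, ?_⟩
    have := edgesWithin_le_extremalNumber hr U'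
    rw [hU'] at this
    unfold gTuran
    omega
  -- Twice `t + 1` is at least `k`.
  have hclique : ∀ x ∈ K, ∀ y ∈ K, x ≠ y → G'.Adj x y := fun x hx y hy hxy =>
    hsat.adj_of_degrees hG' (by omega) hK hK (by omega) hx hy hxy
  have hdeg : ∀ x ∈ K, K.card - 1 ≤ (K.filter (G'.Adj x)).card := by
    intro x hx
    rw [← Finset.card_erase_of_mem hx]
    refine Finset.card_le_card fun y hy => ?_
    rw [Finset.mem_erase] at hy
    exact Finset.mem_filter.2 ⟨hy.2, hclique x hx y hy.2 hy.1.symm⟩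
  have hupper := hsat.1.clique_card_lt hG' (by omega) (by omega) hclique
  have hlower : t + 2 ≤ K.card := by
    obtain ⟨x, hx⟩ := Finset.nonempty_iff_ne_empty.2 hK0
    have h1 := hK x hx
    have h2 : (K.filter (G'.Adj x)).card < K.card :=
      Finset.card_lt_card (Finset.filter_ssubset.2 ⟨x, hx, by simp⟩)
    omega
  obtain ⟨L, hL, hLmax⟩ := exists_core G' (k - K.card)
  have hKL : K ⊆ L := hLmax K fun x hx => le_trans (by omega) (hK x hx)
  have hLK : L = K := by
    refine Finset.Subset.antisymm (fun y hy => ?_) hKL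
    by_contra hyK
    -- The inner degrees `|K| - 1` and `k - |K| + 1` add up to `k`. So `y` could be added to `K`,
    -- against maximality.
    have hyadj : ∀ x ∈ K, G'.Adj x y := fun x hx =>
      hsat.adj_of_degrees hG' (by omega) hdeg hL (by omega) hx hy (by rintro rfl; exact hyK hx)
    have hins : MinInnerDegreeGT G' t (insert y K) := by
      intro x hx
      rcases Finset.mem_insert.1 hx with rfl | hx
      · refine le_trans (by omega : t + 1 ≤ K.card) (Finset.card_le_card fun z hz => ?_)
        exact Finset.mem_filter.2 ⟨Finset.mem_insert_of_mem hz, (hyadj z hz).symm⟩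
      · exact (hK x hx).trans
          (Finset.card_le_card (Finset.filter_subset_filter _ (Finset.subset_insert _ _)))
    exact hyK (hKmax _ hins (Finset.mem_insert_self _ _))
  subst hLK
  obtain ⟨U', -, hU', he⟩ := exists_subset_edgesWithin_le hle hL hLmax (m := L.card) le_rfl
      (n - L.card) Finset.univ (by rw [Finset.card_univ, hV]; omega) (Finset.subset_univ _)
  refine ⟨k - L.card, by omega, by omega, ?_⟩
  have := edgesWithin_le_extremalNumber hr U'
  rw [hU'] at this
  unfold gTuran
  rw [show k - (k - L.card) = L.card by omega, show n - k + (k - L.card) = n - L.card by omega]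
  omega

end Counting

/-! ### Convexity of the bound in `a`. -/

section Convexity

/-- By Turán's theorem: one vertex from each of the `r - 1` parts gives a clique, and every
remaining vertex is adjacent to all but one of its members. -/
lemma extremalNumber_top_add (r m : ℕ) (hr : 2 ≤ r) :
    SimpleGraph.extremalNumber (m + (r - 1)) (⊤ : SimpleGraph (Fin r)) =
      SimpleGraph.extremalNumber m (⊤ : SimpleGraph (Fin r)) + m * (r - 2) + (r - 1).choose 2 := by
  have : Nontrivial (Fin r) := Fin.nontrivial_iff_two_le.2 hr
  rw [SimpleGraph.extremalNumber_top, SimpleGraph.extremalNumber_top, Fintype.card_fin,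
    SimpleGraph.card_edgeFinset_turanGraph_add, show r - 1 - 1 = r - 2 by omega]

lemma extremalNumber_top_of_lt (r m : ℕ) (hr : 2 ≤ r) (hm : m < r) :
    SimpleGraph.extremalNumber m (⊤ : SimpleGraph (Fin r)) = m.choose 2 := by
  have : Nontrivial (Fin r) := Fin.nontrivial_iff_two_le.2 hr
  rw [SimpleGraph.extremalNumber_top, Fintype.card_fin]
  have h : SimpleGraph.turanGraph m (r - 1) = ⊤ := SimpleGraph.turanGraph_eq_top.2 (.inr (by omega))
  have key : ∀ (H : SimpleGraph (Fin m)) [DecidableRel H.Adj], H = ⊤ →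
      H.edgeFinset.card = m.choose 2 := by
    intro H _ hH
    subst hH
    have := SimpleGraph.card_edgeFinset_top_eq_card_choose_two (V := Fin m)
    rw [Fintype.card_fin] at this
    rw [← this]
    congr!
  exact key _ h

/-- The Turán numbers are almost convex. -/
lemma two_mul_extremalNumber_top_le (r m : ℕ) (hr : 2 ≤ r) :
    2 * SimpleGraph.extremalNumber (m + 1) (⊤ : SimpleGraph (Fin r)) ≤
      SimpleGraph.extremalNumber m (⊤ : SimpleGraph (Fin r)) +
      SimpleGraph.extremalNumber (m + 2) (⊤ : SimpleGraph (Fin r)) + 2 := by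
  induction m using Nat.strong_induction_on with
  | _ m ih =>
  by_cases hm : r - 1 ≤ m
  -- A shift by `r - 1` adds an affine function of `m`, which leaves second differences unchanged.
  · obtain ⟨j, rfl⟩ := Nat.exists_eq_add_of_le' hm
    have := ih j (by omega)
    rw [show j + (r - 1) + 1 = (j + 1) + (r - 1) by ring,
      show j + (r - 1) + 2 = (j + 2) + (r - 1) by ring, extremalNumber_top_add _ _ hr,
      extremalNumber_top_add _ _ hr, extremalNumber_top_add _ _ hr]
    nlinarith
  · have h0 := extremalNumber_top_of_lt r m hr (by omega)
    have h1 := extremalNumber_top_of_lt r (m + 1) hr (by omega)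
    have c1 : (m + 1).choose 2 = m.choose 2 + m := by
      rw [Nat.choose_succ_succ' m 1, Nat.choose_one_right, add_comm]
    rw [h0, h1, c1]
    by_cases hm' : m + 2 < r
    · have c2 : (m + 2).choose 2 = (m + 1).choose 2 + (m + 1) := by
        rw [Nat.choose_succ_succ' (m + 1) 1, Nat.choose_one_right, add_comm]
      rw [extremalNumber_top_of_lt r (m + 2) hr hm', c2, c1]
      omega
    · obtain rfl : r = m + 2 := by omega
      have h2 := extremalNumber_top_add (m + 2) 1 hr
      rw [show 1 + (m + 2 - 1) = m + 2 by omega, show m + 2 - 1 = m + 1 by omega, c1] at h2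
      rw [h2]
      omega

/-- A convex sequence on an interval is bounded by its values at the ends. -/
lemma le_max_of_convex (f : ℕ → ℕ) (lo hi : ℕ)
    (h : ∀ a, lo ≤ a → a + 2 ≤ hi → 2 * f (a + 1) ≤ f a + f (a + 2)) :
    ∀ a, lo ≤ a → a ≤ hi → f a ≤ max (f lo) (f hi) := by
  -- By convexity, a descent at one step forces descents at all earlier steps.
  have hdec : ∀ j, lo + j + 1 ≤ hi → f (lo + j + 1) < f (lo + j) → f (lo + j) ≤ f lo := by
    intro j
    induction j with
    | zero => simp
    | succ j ih =>
      intro h1 h2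
      have h3 := h (lo + j) (by omega) (by omega)
      rw [show lo + j + 2 = lo + j + 1 + 1 from rfl] at h3
      have h4 := ih (by omega) (by
        rw [← add_assoc] at h2
        omega)
      rw [← add_assoc] at h2 ⊢
      omega
  have main : ∀ j a, lo ≤ a → a + j = hi → f a ≤ max (f lo) (f hi) := by
    intro j
    induction j with
    | zero =>
      intro a _ ha
      obtain rfl : a = hi := by omega
      exact le_max_right _ _
    | succ j ih =>
      intro a ha haj
      have h1 := ih (a + 1) (by omega) (by omega)
      by_cases h2 : f a ≤ f (a + 1)
      · exact h2.trans h1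
      · have := hdec (a - lo) (by omega) (by
          rw [show lo + (a - lo) = a by omega]
          omega)
        rw [show lo + (a - lo) = a by omega] at this
        exact this.trans (le_max_left _ _)
  exact fun a ha hah => main (hi - a) a ha (by omega)

/-- The term `a (n - k + a)` has second difference 2, which absorbs the slack 2 in
`two_mul_extremalNumber_top_le`. -/
lemma gTuran_le_max {n k r : ℕ} (hr : 2 ≤ r) {a : ℕ} (ha : 2 ≤ a)
    (hak : a ≤ (k - 1) / 2) :
    gTuran r n a k ≤ max (gTuran r n 2 k) (gTuran r n ((k - 1) / 2) k) := by
  refine le_max_of_convex (fun a => gTuran r n a k) 2 ((k - 1) / 2) ?_ a ha hak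
  intro a _ ha'
  have h := two_mul_extremalNumber_top_le r (k - (a + 2)) hr
  simp only [gTuran]
  rw [show k - (a + 2) + 1 = k - (a + 1) by omega, show k - (a + 2) + 2 = k - a by omega] at h
  generalize n - k = N
  nlinarith

end Convexity

/-! ### The extremal graphs. -/

section Construction

/-- The Turán graph with `p` parts on the first `m` of `n` vertices, whose first `a` vertices are
also joined to all of the last `n - m` vertices. -/
def turanWithIndependent (n m a p : ℕ) : SimpleGraph (Fin n) where
  Adj i j := i ≠ j ∧ ((i.val < m ∧ j.val < m ∧ i.val % p ≠ j.val % p) ∨ (i.val < a ∧ m ≤ j.val) ∨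
    (j.val < a ∧ m ≤ i.val))
  symm := ⟨fun i j h => by
    obtain ⟨h1, h2⟩ := h
    exact ⟨h1.symm, by tauto⟩⟩
  loopless := ⟨fun i h => h.1 rfl⟩

variable {n m a p : ℕ}

/-- Next to a vertex at `m` or above, a clique has only vertices below `a < p`; any other clique has
distinct residues mod `p`. -/
lemma turanWithIndependent_cliqueFree (hap : a < p) (ham : a ≤ m) :
    (turanWithIndependent n m a p).CliqueFree (p + 1) := by
  intro s hs
  rw [SimpleGraph.isNClique_iff, SimpleGraph.isClique_iff] at hs
  obtain ⟨hcl, hcard⟩ := hs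
  by_cases hB : ∃ b ∈ s, m ≤ b.val
  · obtain ⟨b, hb, hmb⟩ := hB
    have h1 : ((s.erase b).image Fin.val).card ≤ (Finset.range a).card := by
      apply Finset.card_le_card
      intro i hi
      rw [Finset.mem_image] at hi
      obtain ⟨j, hj, rfl⟩ := hi
      rw [Finset.mem_erase] at hj
      have := hcl (Finset.mem_coe.2 hj.2) (Finset.mem_coe.2 hb) hj.1
      rw [Finset.mem_range]
      rcases this with ⟨-, h | h | h⟩ <;> omega
    rw [Finset.card_image_of_injective _ Fin.val_injective, Finset.card_erase_of_mem hb,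
      Finset.card_range] at h1
    omega
  · push Not at hB
    have h1 : s.card ≤ (Finset.range p).card := by
      apply Finset.card_le_card_of_injOn (fun i => i.val % p)
      · intro i _
        simpa using Nat.mod_lt _ (by omega)
      · intro i hi j hj hij
        by_contra hne
        rcases hcl hi hj hne with ⟨-, h | h | h⟩
        · exact h.2.2 hij
        · have := hB j hj; omega
        · have := hB i hi; omega
    rw [Finset.card_range] at h1
    omega

/-- The vertices at `m` and above form an independent set with neighbours below `a` only, so a path
from below `a` visits few of them. -/
lemma countP_independent_le {l : List (Fin n)} (ham : a ≤ m) :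
    ∀ x, l.head? = some x → l.IsChain (turanWithIndependent n m a p).Adj →
    l.countP (fun i => m ≤ i.val) + (if ∃ i ∈ l, a ≤ i.val ∧ i.val < m then 1 else 0) ≤
      l.countP (fun i => i.val < a) + (if x.val < a then 0 else 1) := by
  -- Charge each vertex at `m` or above, and the first vertex in `[a, m)`, to its predecessor, which
  -- is below `a`; if it is the head, charge it to the last term.
  induction l with
  | nil => simp
  | cons y l ih =>
    intro x hx hl
    obtain rfl : y = x := by simpa using hx
    cases l with
    | nil =>
      simp only [List.countP_cons, List.countP_nil, List.mem_singleton, exists_eq_left,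
        decide_eq_true_eq]
      split_ifs <;> omega
    | cons z l =>
      have hyz := (List.isChain_cons_cons.1 hl).1
      have := ih z (by simp) (List.isChain_cons_cons.1 hl).2
      rw [List.countP_cons, List.countP_cons (l := z :: l)]
      simp only [decide_eq_true_eq]
      have hex : (∃ i ∈ y :: z :: l, a ≤ i.val ∧ i.val < m) ↔
          (a ≤ y.val ∧ y.val < m) ∨ ∃ i ∈ z :: l, a ≤ i.val ∧ i.val < m := by
        simp only [List.mem_cons, exists_eq_or_imp]
      have hz : (a ≤ z.val ∧ z.val < m) → ∃ i ∈ z :: l, a ≤ i.val ∧ i.val < m :=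
        fun h => ⟨z, by simp, h⟩
      rw [if_congr hex rfl rfl]
      by_cases hc : ∃ i ∈ z :: l, a ≤ i.val ∧ i.val < m
      · simp only [hc, or_true, if_true] at this ⊢
        rcases hyz with ⟨-, h | h | h⟩ <;> split_ifs at this ⊢ <;> omega
      · have hzc : ¬ (a ≤ z.val ∧ z.val < m) := fun h => hc (hz h)
        simp only [hc, or_false, if_false] at this ⊢
        rcases hyz with ⟨-, h | h | h⟩ <;> split_ifs at this ⊢ <;> omega

lemma SimpleGraph.Walk.IsCycle.exists_pathList {V : Type*} {G : SimpleGraph V} {v : V}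
    {c : G.Walk v v} (hc : c.IsCycle) :
    ∃ l w, PathList G l v w ∧ l.length = c.length ∧ ∀ u ∈ l, u ∈ c.support := by
  cases c with
  | nil => simp at hc
  | cons h q =>
    rw [SimpleGraph.Walk.cons_isCycle_iff] at hc
    exact ⟨_, _, hc.1.reverse.pathList, by simp, by simp +contextual⟩

lemma List.countP_le_of_nodup {l : List (Fin n)} (hl : l.Nodup) (b c : ℕ) :
    l.countP (fun i => b ≤ i.val ∧ i.val < c) ≤ c - b := by
  rw [← hl.card_filter_toFinset (fun i => b ≤ i.val ∧ i.val < c), ← Nat.card_Ico,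
    ← Finset.card_image_of_injective _ Fin.val_injective]
  refine Finset.card_le_card fun i hi => ?_
  simp only [Finset.mem_image, Finset.mem_filter] at hi
  obtain ⟨j, ⟨-, hj⟩, rfl⟩ := hi
  simpa using hj

lemma List.length_eq_countP_three (l : List (Fin n)) (ham : a ≤ m) :
    l.length = l.countP (fun i => 0 ≤ i.val ∧ i.val < a) +
      l.countP (fun i => a ≤ i.val ∧ i.val < m) + l.countP (fun i => m ≤ i.val) := by
  induction l with
  | nil => simp
  | cons x l ih =>
    simp only [List.length_cons, List.countP_cons, decide_eq_true_eq]
    rw [ih]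
    split_ifs <;> omega

/-- Start the cycle below `a` if possible. If it meets `[a, m)`, the extra unit in
`countP_independent_le` leaves at most `a + (m - a) + (a - 1)` vertices; if not, at most `2a < m +
a`. -/
lemma turanWithIndependent_longCycleFree (ha : 0 < a) (ham : a < m) :
    LongCycleFree (turanWithIndependent n m a p) (m + a) := by
  intro v c hc
  by_cases hA : ∃ u ∈ c.support, u.val < a
  · obtain ⟨u, hu, hua⟩ := hA
    obtain ⟨l, w, hl, hlen, -⟩ := (hc.rotate hu).exists_pathList
    rw [SimpleGraph.Walk.length_rotate] at hlen
    have h1 := countP_independent_le ham.le u hl.2.2.1 hl.1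
    have h2 := List.countP_le_of_nodup hl.2.1 0 a
    have h3 := List.countP_le_of_nodup hl.2.1 a m
    have h4 := List.length_eq_countP_three l ham.le
    simp only [Nat.zero_le, true_and] at h2 h4
    rw [if_pos hua] at h1
    split_ifs at h1 with hC
    · omega
    · have h5 : l.countP (fun i => a ≤ i.val ∧ i.val < m) = 0 := by
        rw [List.countP_eq_zero]
        intro i hi
        simpa using fun h h' => hC ⟨i, hi, h, h'⟩
      omega
  · push Not at hA
    obtain ⟨l, w, hl, hlen, hsup⟩ := hc.exists_pathList
    have h1 := countP_independent_le ham.le v hl.2.2.1 hl.1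
    have h3 := List.countP_le_of_nodup hl.2.1 a m
    have h4 := List.length_eq_countP_three l ham.le
    simp only [Nat.zero_le, true_and] at h4
    have h6 : l.countP (fun i => i.val < a) = 0 := by
      rw [List.countP_eq_zero]
      intro i hi
      simpa using hA i (hsup i hi)
    have h7 := hc.three_le_length
    have hv : ¬ v.val < a := not_lt.2 (hA v (by simp))
    rw [if_neg hv] at h1
    split_ifs at h1 with hC
    · omega
    · have h5 : l.countP (fun i => a ≤ i.val ∧ i.val < m) = 0 := by
        rw [List.countP_eq_zero]
        intro i hi
        simpa using fun h h' => hC ⟨i, hi, h, h'⟩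
      omega

lemma SimpleGraph.connected_of_hubs {W : Type*} (H : SimpleGraph W) (S : Set W) (hne : Nonempty W)
    (hS : ∀ x ∈ S, ∀ y ∈ S, x ≠ y → H.Adj x y) (h : ∀ x, ∃ s ∈ S, x = s ∨ H.Adj x s) :
    H.Connected := by
  have hr : ∀ x, ∃ s ∈ S, H.Reachable x s := by
    intro x
    obtain ⟨s, hs, rfl | hx⟩ := h x
    · exact ⟨x, hs, .refl _⟩
    · exact ⟨s, hs, hx.reachable⟩
  refine ⟨fun x y => ?_⟩
  obtain ⟨s, hs, hxs⟩ := hr x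
  obtain ⟨t, ht, hyt⟩ := hr y
  by_cases hst : s = t
  · exact hxs.trans (hst ▸ hyt.symm)
  · exact hxs.trans ((hS s hs t ht hst).reachable.trans hyt.symm)

/-- Vertices 0, 1, 2 form a triangle and every other vertex is adjacent to at least two of them, so
one deletion cannot disconnect the graph. -/
lemma turanWithIndependent_isTwoConnected (ha : 2 ≤ a) (ham : a < m) (hmn : m ≤ n) (hp : 3 ≤ p) :
    IsTwoConnected (turanWithIndependent n m a p) := by
  have hS : ∀ x ∈ {i : Fin n | i.val < 3}, ∀ y ∈ {i : Fin n | i.val < 3}, x ≠ y →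
      (turanWithIndependent n m a p).Adj x y := by
    intro x hx y hy hxy
    simp only [Set.mem_ofPred_eq] at hx hy
    refine ⟨hxy, .inl ⟨by omega, by omega, ?_⟩⟩
    rw [Nat.mod_eq_of_lt (by omega), Nat.mod_eq_of_lt (by omega)]
    exact fun h => hxy (Fin.ext h)
  have hhub : ∀ v x : Fin n, x ≠ v → ∃ s : Fin n, s.val < 3 ∧ s ≠ v ∧
      (x = s ∨ (turanWithIndependent n m a p).Adj x s) := by
    intro v x hxv
    by_cases hx3 : x.val < 3
    · exact ⟨x, hx3, hxv, .inl rfl⟩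
    have key : ∀ i : ℕ, (hi : i < 3) → (x.val < m → x.val % p ≠ i) → (m ≤ x.val → i < 2) →
        (turanWithIndependent n m a p).Adj x ⟨i, by omega⟩ := by
      intro i hi h1 h2
      refine ⟨fun h => hx3 (by rw [h]; exact hi), ?_⟩
      by_cases hxm : x.val < m
      · refine .inl ⟨hxm, by simp; omega, ?_⟩
        simpa [Nat.mod_eq_of_lt (show i < p by omega)] using h1 hxm
      · exact .inr (.inr ⟨by have := h2 (by omega); simp; omega, by omega⟩)
    obtain ⟨i, hi, hiv, h1, h2⟩ : ∃ i < 3, i ≠ v.val ∧ (x.val < m → x.val % p ≠ i) ∧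
        (m ≤ x.val → i < 2) := by
      generalize x.val % p = y
      by_cases hxm : x.val < m
      · by_cases c0 : v.val ≠ 0 ∧ y ≠ 0
        · exact ⟨0, by omega, by omega, by omega, by omega⟩
        by_cases c1 : v.val ≠ 1 ∧ y ≠ 1
        · exact ⟨1, by omega, by omega, by omega, by omega⟩
        · exact ⟨2, by omega, by omega, by omega, by omega⟩
      · by_cases c0 : v.val = 0
        · exact ⟨1, by omega, by omega, by omega, by omega⟩
        · exact ⟨0, by omega, by omega, by omega, by omega⟩
    exact ⟨⟨i, by omega⟩, hi, fun h => hiv (by rw [← h]), .inr (key i hi h1 h2)⟩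
  refine ⟨by rw [Fintype.card_fin]; omega, ?_, ?_⟩
  · refine SimpleGraph.connected_of_hubs _ _ ⟨⟨0, by omega⟩⟩ hS fun x => ?_
    by_cases hx0 : x.val = 0
    · exact ⟨x, by simp [hx0], .inl rfl⟩
    · obtain ⟨s, hs, -, h⟩ := hhub ⟨0, by omega⟩ x (fun h => hx0 (by rw [h]))
      exact ⟨s, hs, h⟩
  · intro v
    refine SimpleGraph.connected_of_hubs _ {i | i.val.val < 3} ?_ ?_ ?_
    · by_cases hv : v.val = 0
      · exact ⟨⟨⟨1, by omega⟩, fun h => by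
          rw [Set.mem_singleton_iff] at h; rw [← h] at hv; simp at hv⟩⟩
      · exact ⟨⟨⟨0, by omega⟩, fun h => by
          rw [Set.mem_singleton_iff] at h; rw [← h] at hv; simp at hv⟩⟩
    · intro x hx y hy hxy
      exact hS x.val hx y.val hy fun h => hxy (Subtype.ext h)
    · intro x
      obtain ⟨s, hs, hsv, h⟩ := hhub v x.val x.2
      refine ⟨⟨s, hsv⟩, hs, h.imp (fun h => Subtype.ext h) fun h => h⟩

/-- One inequality suffices, since the upper bound of the main theorem supplies the other. -/
lemma le_ncard_edgeSet_turanWithIndependent (ham : a ≤ m) (hmn : m ≤ n) :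
    a * (n - m) + (SimpleGraph.turanGraph m p).edgeFinset.card ≤
      (turanWithIndependent n m a p).edgeSet.ncard := by
  classical
  rw [← SimpleGraph.coe_edgeFinset, Set.ncard_coe_finset]
  let f : Fin a × Fin (n - m) → Sym2 (Fin n) := fun x =>
    s(⟨x.1.val, by omega⟩, ⟨m + x.2.val, by omega⟩)
  have hf : Function.Injective f := by
    rintro ⟨i, j⟩ ⟨i', j'⟩ h
    simp only [f, Sym2.eq_iff, Fin.mk.injEq] at h
    rw [Prod.mk.injEq, Fin.ext_iff, Fin.ext_iff]
    omega
  let g : Sym2 (Fin m) → Sym2 (Fin n) := Sym2.map (Fin.castLE hmn)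
  have hg : Function.Injective g := Sym2.map.injective (Fin.castLE_injective hmn)
  have h1 : (Finset.univ.image f).card = a * (n - m) := by
    rw [Finset.card_image_of_injective _ hf]; simp
  have h2 := Finset.card_image_of_injective (SimpleGraph.turanGraph m p).edgeFinset hg
  rw [← h1, ← h2, ← Finset.card_union_of_disjoint]
  · refine Finset.card_le_card (Finset.union_subset ?_ ?_)
    · intro e he
      rw [Finset.mem_image] at he
      obtain ⟨⟨i, j⟩, -, rfl⟩ := he
      simp only [f, SimpleGraph.mem_edgeFinset, SimpleGraph.mem_edgeSet]
      refine ⟨fun h => ?_, .inr (.inl ⟨i.2, by simp⟩)⟩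
      rw [Fin.mk.injEq] at h
      omega
    · intro e he
      rw [Finset.mem_image] at he
      obtain ⟨e, he, rfl⟩ := he
      induction e with
      | _ i j =>
        rw [SimpleGraph.mem_edgeFinset, SimpleGraph.mem_edgeSet, SimpleGraph.turanGraph_adj] at he
        simp only [g, Sym2.map_mk, SimpleGraph.mem_edgeFinset]
        refine ⟨fun h => he ?_, .inl ⟨by simp, by simp, by simpa using he⟩⟩
        rw [Fin.castLE_injective hmn h]
  · rw [Finset.disjoint_left]
    intro e he he'
    rw [Finset.mem_image] at he he'
    obtain ⟨⟨i, j⟩, -, rfl⟩ := he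
    obtain ⟨e, -, he⟩ := he'
    induction e with
    | _ i' j' =>
      simp only [f, g, Sym2.map_mk, Sym2.eq_iff, Fin.ext_iff, Fin.val_castLE] at he
      omega

/-- The graph attaining `gTuran r n a k`. -/
lemma exists_twoConnEdgeCounts_ge {k r : ℕ} (hkn : k ≤ n) (ha : 2 ≤ a) (hak : 2 * a < k)
    (har : a + 2 ≤ r) : ∃ e ∈ twoConnEdgeCounts n r k, gTuran r n a k ≤ e := by
  have : Nontrivial (Fin r) := Fin.nontrivial_iff_two_le.2 (by omega)
  -- Taking `m = k - a` turns the cycle bound `m + a` into `k`; `a + 2 ≤ r` gives fewer than `r - 1`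
  -- joined vertices.
  refine ⟨_, ⟨turanWithIndependent n (k - a) a (r - 1),
    turanWithIndependent_isTwoConnected ha (by omega) (by omega) (by omega), ?_, ?_, rfl⟩, ?_⟩
  · have := turanWithIndependent_cliqueFree (n := n) (m := k - a) (a := a) (p := r - 1)
      (by omega) (by omega)
    rwa [show r - 1 + 1 = r by omega] at this
  · have := turanWithIndependent_longCycleFree (n := n) (m := k - a) (a := a) (p := r - 1)
      (by omega) (by omega)
    rwa [show k - a + a = k by omega] at this
  · have := le_ncard_edgeSet_turanWithIndependent (n := n) (m := k - a) (a := a) (p := r - 1)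
      (by omega) (by omega)
    unfold gTuran
    rw [SimpleGraph.extremalNumber_top, Fintype.card_fin, show n - k + a = n - (k - a) by omega]
    exact this

end Construction

/-! ### The main theorem. -/

theorem theorem4 (n k r : ℕ) (hk : 5 ≤ k) (hkn : k ≤ n)
    (hr : (k - 1) / 2 + 2 ≤ r) (hrk : r < k) :
    IsGreatest (twoConnEdgeCounts n r k)
      (max (gTuran r n 2 k) (gTuran r n ((k - 1) / 2) k)) := by
  have hub : max (gTuran r n 2 k) (gTuran r n ((k - 1) / 2) k) ∈
      upperBounds (twoConnEdgeCounts n r k) := by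
    rintro _ ⟨G, hG, hfree, hcyc, rfl⟩
    obtain ⟨a, ha, hak, hle⟩ :=
      exists_ncard_edgeSet_le_gTuran hk hkn (Fintype.card_fin n) hG hfree hcyc
    exact hle.trans (gTuran_le_max (by omega) ha hak)
  refine ⟨?_, hub⟩
  obtain ⟨e, he, hle⟩ : ∃ e ∈ twoConnEdgeCounts n r k,
      max (gTuran r n 2 k) (gTuran r n ((k - 1) / 2) k) ≤ e := by
    -- The lower bound on `r` is what allows the construction with `a = (k - 1) / 2`, and hence also
    -- with `a = 2`.
    rcases max_choice (gTuran r n 2 k) (gTuran r n ((k - 1) / 2) k) with h | h <;> rw [h]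
    · exact exists_twoConnEdgeCounts_ge hkn (by omega) (by omega) (by omega)
    · exact exists_twoConnEdgeCounts_ge hkn (by omega) (by omega) (by omega)
  rwa [le_antisymm hle (hub he)]
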